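/- Let $\dot{\mathfrak g}$ be a finite-dimensional simple Lie algebra over $\mathbb C$ with Cartan subalgebra $\dot{\mathfrak h}$, simple roots $\alpha_1,\dots,\alpha_d$, maximal root $\beta$, and $\dot{\mathfrak g}^{+}$ the sum of the positive root spaces. Let $(\,,)$ be the invariant symmetric bilinear form on $\dot{\mathfrak g}$ normalized by $(\beta,\beta)=2$. Let $n\ge 0$, $A=\mathbb C[t_0^{\pm1},\dots,t_n^{\pm1}]$, and let $B$ be a finitely generated commutative associative unital $\mathbb C$-algebra. Let $Z=\Omega_A/dA$, where $\Omega_A$ has basis the symbols $t^kK_i$ ($k\in\mathbb Z^{n+1}$, $0\le i\le n$) and $dA$ is spanned by the elements $\sum_{i=0}^n k_i\,t^kK_i$. The loop toroidal Lie algebra is $$\tau(B)=\dot{\mathfrak g}\otimes A\otimes B\;\oplus\; Z\otimes B\;\oplus\;\bigoplus_{i=0}^n\mathbb C d_i$$ with brackets $$[x\otimes t^k\otimes b,\;y\otimes t^r\otimes b']=[x,y]\otimes t^{k+r}\otimes bb'+(x,y)\sum_{i=0}^n k_i\,t^{k+r}K_i\otimes bb',$$ $$[d_i,x\otimes t^k\otimes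 b]=k_i\,x\otimes t^k\otimes b,\qquad [d_i,t^kK_j\otimes b]=k_i\,t^kK_j\otimes b,\qquad [d_i,d_j]=0,$$ and with $Z\otimes B$ central in $\dot{\mathfrak g}\otimes A\otimes B\oplus Z\otimes B$. Write $K_i=t^0K_i\otimes 1$, identify $\dot{\mathfrak h}$ with $\dot{\mathfrak h}\otimes1\otimes1$, and put $H=\dot{\mathfrak h}\oplus\bigoplus_{i=0}^n\mathbb CK_i\oplus\bigoplus_{i=0}^n\mathbb Cd_i$. Let $$\tau(B)^+=\dot{\mathfrak g}^+\otimes\mathbb C[t_1^{\pm1},\dots,t_n^{\pm1}]\otimes B\;\oplus\;\dot{\mathfrak g}\otimes t_0\mathbb C[t_0,t_1^{\pm1},\dots,t_n^{\pm1}]\otimes B\;\oplus\;\Big(\sum_{i=0}^n t_0\mathbb C[t_0,t_1^{\pm1},\dots,t_n^{\pm1}]K_i\Big)\otimes B .$$ A $\tau(B)$-module $V$ is integrable if it is the direct sum of its weight spaces $V_\lambda=\{v: hv=\lambda(h)v\ \forall h\in H\}$, $\lambda\in H^*$, and if for every root $\alpha$ of $\dot{\mathfrak g}$, every root vector $X_\alpha$,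 every $k\in\mathbb Z^{n+1}$ and $b\in B$, the element $X_\alpha\otimes t^k\otimes b$ acts locally nilpotently on $V$. **Proposition.** Let $V$ be an irreducible integrable $\tau(B)$-module all of whose weight spaces $V_\lambda$ are finite-dimensional. Assume that $K_0$ acts on $V$ as a positive integer $c_0$ and that $K_1,\dots,K_n$ act on $V$ as zero. Then: 1. there is a nonzero weight vector $v\in V$ with $\tau(B)^+v=0$; 2. whenever $0\ne v\in V_\lambda$ satisfies $\tau(B)^+v=0$, the weight $\lambda$ is dominant integral for the affine algebra $\dot{\mathfrak g}\otimes\mathbb C[t_0^{\pm1}]\oplus\mathbb CK_0\oplus\mathbb Cd_0$, that is, $\lambda(\alpha_i^\vee)\in\mathbb Z_{\ge0}$ for $0\le i\le d$. Here $\alpha_1^\vee,\dots,\alpha_d^\vee\in\dot{\mathfrak h}$ are the simple coroots of $\dot{\mathfrak g}$, and $\alpha_0^\vee=K_0-\beta^\vee$ is the coroot of $\alpha_0=\delta_0-\beta$, where $\delta_0\in H^*$ satisfies $\delta_0(d_0)=1$ and vanishes on $\dot{\mathfrak h}$, on every $K_i$, and on $d_1,\dots,d_n$. -/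

import Mathlib

open scoped TensorProduct

noncomputable section

namespace Toroidal

/-! ### Laurent polynomials and the space `Z = Ω_A / dA` -/

section Laurent

variable (n : ℕ)

/-- The Laurent polynomial ring `A = ℂ[t₀^±1, …, t_n^±1]` as the group algebra of `ℤ^(n+1)`; the
monomial `t₀^k₀ ⋯ t_n^k_n` is `AddMonoidAlgebra.single k 1`. -/
abbrev Laurent : Type := AddMonoidAlgebra ℂ (Fin (n + 1) → ℤ)

variable {n}

/-- The monomial `t^k`. -/
def monomial (k : Fin (n + 1) → ℤ) : Laurent n := AddMonoidAlgebra.single k 1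

/-- The degree operator `t_i ∂/∂t_i` on Laurent polynomials, `t^k ↦ k_i t^k`. -/
def euler (i : Fin (n + 1)) : Laurent n →ₗ[ℂ] Laurent n :=
  (AddMonoidAlgebra.basis (Fin (n + 1) → ℤ) ℂ).constr ℂ fun k => (k i : ℂ) • monomial k

variable (n) in
/-- The space `Ω_A` with basis the symbols `t^k K_i`; the coordinate `i` of an element is the
coefficient of `K_i`, a Laurent polynomial. -/
abbrev Omega : Type := Fin (n + 1) → Laurent n

/-- The symbol `t^k K_i`. -/
def symbolK (k : Fin (n + 1) → ℤ) (i : Fin (n + 1)) : Omega n := Pi.single i (monomial k)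

variable (n) in
/-- The subspace `dA` of `Ω_A` spanned by the elements `∑ i, k_i t^k K_i`. -/
def exactForms : Submodule ℂ (Omega n) :=
  Submodule.span ℂ (Set.range fun k : Fin (n + 1) → ℤ => ∑ i, (k i : ℂ) • symbolK k i)

variable (n) in
/-- `Z = Ω_A / dA`. -/
def CentralZ : Type := Omega n ⧸ exactForms n

instance : AddCommGroup (CentralZ n) := inferInstanceAs (AddCommGroup (Omega n ⧸ exactForms n))

instance : Module ℂ (CentralZ n) := inferInstanceAs (Module ℂ (Omega n ⧸ exactForms n))

variable (n) in
/-- The projection `Ω_A → Z`. -/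
def toZ : Omega n →ₗ[ℂ] CentralZ n := (exactForms n).mkQ

theorem toZ_eq_zero_iff (w : Omega n) : toZ n w = 0 ↔ w ∈ exactForms n :=
  Submodule.Quotient.mk_eq_zero _

theorem toZ_surjective : Function.Surjective (toZ n) := (exactForms n).mkQ_surjective

/-- The bilinear map `(f, g) ↦ (df) g` from `A × A` to `Z`; on monomials it is
`(t^k, t^r) ↦ ∑ i, k_i t^(k + r) K_i`. -/
def dMul : Laurent n →ₗ[ℂ] Laurent n →ₗ[ℂ] CentralZ n :=
  LinearMap.mk₂ ℂ (fun f g => toZ n fun i => euler i f * g)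
    (fun f f' g => by rw [← map_add]; congr 1; ext1 i; simp [add_mul])
    (fun c f g => by rw [← map_smul]; congr 1; ext1 i; simp)
    (fun f g g' => by rw [← map_add]; congr 1; ext1 i; simp [mul_add])
    (fun c f g => by rw [← map_smul]; congr 1; ext1 i; simp)

theorem euler_monomial (i : Fin (n + 1)) (k : Fin (n + 1) → ℤ) :
    euler i (monomial k) = (k i : ℂ) • monomial k := by
  have h := (AddMonoidAlgebra.basis (Fin (n + 1) → ℤ) ℂ).constr_basis ℂ
    (fun k => (k i : ℂ) • (monomial k : Laurent n)) k
  rwa [AddMonoidAlgebra.basis_apply] at h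

theorem monomial_mul (k r : Fin (n + 1) → ℤ) :
    (monomial k * monomial r : Laurent n) = monomial (k + r) := by
  simp [monomial, AddMonoidAlgebra.single_mul_single]

theorem dMul_monomial (k r : Fin (n + 1) → ℤ) :
    dMul (monomial k) (monomial r) =
      ∑ i, (k i : ℂ) • toZ n (symbolK (k + r) i) := by
  simp only [← map_smul, ← map_sum]
  simp only [dMul, LinearMap.mk₂_apply]
  congr 1
  ext1 j
  simp [euler_monomial, monomial_mul, symbolK, Finset.sum_apply, Pi.single_apply]

theorem sum_symbolK_eq_zero (k : Fin (n + 1) → ℤ) :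
    ∑ i, (k i : ℂ) • toZ n (symbolK k i) = 0 := by
  simp only [← map_smul, ← map_sum]
  rw [toZ_eq_zero_iff]
  exact Submodule.subset_span ⟨k, rfl⟩

/-- The degree operator on `Ω_A`, `t^k K_j ↦ k_i t^k K_j`. -/
def eulerOmega (i : Fin (n + 1)) : Omega n →ₗ[ℂ] Omega n :=
  LinearMap.pi fun j => euler i ∘ₗ LinearMap.proj j

theorem eulerOmega_symbolK (i : Fin (n + 1)) (k : Fin (n + 1) → ℤ) (j : Fin (n + 1)) :
    eulerOmega i (symbolK k j) = (k i : ℂ) • symbolK k j := by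
  ext1 l
  rcases eq_or_ne l j with rfl | h
  · simp [eulerOmega, symbolK, euler_monomial]
  · simp [eulerOmega, symbolK, h]

theorem exactForms_le_comap (i : Fin (n + 1)) :
    exactForms n ≤ (exactForms n).comap (eulerOmega i) := by
  refine Submodule.span_le.2 ?_
  rintro _ ⟨k, rfl⟩
  have h : eulerOmega i (∑ j, (k j : ℂ) • symbolK k j) =
      (k i : ℂ) • ∑ j, (k j : ℂ) • symbolK k j := by
    simp only [map_sum, map_smul, eulerOmega_symbolK, Finset.smul_sum]
    exact Finset.sum_congr rfl fun j _ => smul_comm _ _ _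
  simp only [Submodule.comap_coe, Set.mem_preimage, SetLike.mem_coe, h]
  exact Submodule.smul_mem _ _ (Submodule.subset_span ⟨k, rfl⟩)

/-- The degree operator on `Z = Ω_A / dA`. -/
def eulerZ (i : Fin (n + 1)) : CentralZ n →ₗ[ℂ] CentralZ n :=
  (exactForms n).mapQ (exactForms n) (eulerOmega i) (exactForms_le_comap i)

theorem eulerZ_symbolK (i : Fin (n + 1)) (k : Fin (n + 1) → ℤ) (j : Fin (n + 1)) :
    eulerZ i (toZ n (symbolK k j)) =
      (k i : ℂ) • toZ n (symbolK k j) := by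
  rw [← map_smul, ← eulerOmega_symbolK]
  rfl

end Laurent

/-! ### The three summands of the loop toroidal algebra -/

section Summands

variable (𝔤 : Type*) [LieRing 𝔤] [LieAlgebra ℂ 𝔤] (n : ℕ) (B : Type*) [CommRing B] [Algebra ℂ B]

/-- The multiloop part `𝔤 ⊗ A ⊗ B`. -/
abbrev LoopPart : Type _ := 𝔤 ⊗[ℂ] (Laurent n ⊗[ℂ] B)

/-- The part `Z ⊗ B`. -/
abbrev CentralPart : Type _ := CentralZ n ⊗[ℂ] B

variable {𝔤 n B}

/-- The element `x ⊗ t^k ⊗ b` of the multiloop part. -/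
def loopTensor (x : 𝔤) (k : Fin (n + 1) → ℤ) (b : B) : LoopPart 𝔤 n B :=
  x ⊗ₜ[ℂ] (monomial k ⊗ₜ[ℂ] b)

/-- The element `t^k K_i ⊗ b` of `Z ⊗ B`. -/
def centralTensor (k : Fin (n + 1) → ℤ) (i : Fin (n + 1)) (b : B) : CentralPart n B :=
  toZ n (symbolK k i) ⊗ₜ[ℂ] b

/-- The bracket of the multiloop algebra,
`[x ⊗ f ⊗ b, y ⊗ g ⊗ b'] = [x, y] ⊗ f g ⊗ b b'`. -/
def loopBracket : LoopPart 𝔤 n B →ₗ[ℂ] LoopPart 𝔤 n B →ₗ[ℂ] LoopPart 𝔤 n B :=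
  TensorProduct.map₂ (LieModule.toEnd ℂ 𝔤 𝔤 : 𝔤 →ₗ[ℂ] _) (LinearMap.mul ℂ (Laurent n ⊗[ℂ] B))

/-- The central term of the bracket, `(x ⊗ f ⊗ b, y ⊗ g ⊗ b') ↦ (x, y) (df) g ⊗ b b'`, for a
bilinear form `( , )` on `𝔤`. -/
def cocycle (Φ : LinearMap.BilinForm ℂ 𝔤) :
    LoopPart 𝔤 n B →ₗ[ℂ] LoopPart 𝔤 n B →ₗ[ℂ] CentralPart n B :=
  (TensorProduct.map₂ Φ (TensorProduct.map₂ dMul (LinearMap.mul ℂ B))).compr₂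
    (TensorProduct.lid ℂ (CentralPart n B)).toLinearMap

/-- The action of `∑ i, a_i d_i` on the multiloop part: `x ⊗ t^k ⊗ b ↦ (∑ a_i k_i) x ⊗ t^k ⊗ b`. -/
def derLoop : (Fin (n + 1) → ℂ) →ₗ[ℂ] LoopPart 𝔤 n B →ₗ[ℂ] LoopPart 𝔤 n B :=
  ∑ i, (LinearMap.proj i).smulRight (((euler i).rTensor B).lTensor 𝔤)

/-- The action of `∑ i, a_i d_i` on `Z ⊗ B`: `t^k K_j ⊗ b ↦ (∑ a_i k_i) t^k K_j ⊗ b`. -/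
def derCentral : (Fin (n + 1) → ℂ) →ₗ[ℂ] CentralPart n B →ₗ[ℂ] CentralPart n B :=
  ∑ i, (LinearMap.proj i).smulRight ((eulerZ i).rTensor B)

theorem loopBracket_loopTensor (x y : 𝔤) (k r : Fin (n + 1) → ℤ) (b c : B) :
    loopBracket (loopTensor x k b) (loopTensor y r c) = loopTensor ⁅x, y⁆ (k + r) (b * c) := by
  simp [loopBracket, loopTensor, monomial_mul]

theorem cocycle_loopTensor (Φ : LinearMap.BilinForm ℂ 𝔤) (x y : 𝔤) (k r : Fin (n + 1) → ℤ)
    (b c : B) :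
    cocycle Φ (loopTensor x k b) (loopTensor y r c) =
      Φ x y • ∑ i, (k i : ℂ) • centralTensor (k + r) i (b * c) := by
  simp only [cocycle, loopTensor, LinearMap.compr₂_apply, TensorProduct.map₂_apply_tmul,
    TensorProduct.map_tmul, dMul_monomial, LinearMap.mul_apply', LinearEquiv.coe_coe,
    TensorProduct.lid_tmul, TensorProduct.sum_tmul, TensorProduct.smul_tmul', centralTensor]

theorem derLoop_loopTensor (a : Fin (n + 1) → ℂ) (x : 𝔤) (k : Fin (n + 1) → ℤ) (b : B) :
    derLoop a (loopTensor x k b) = (∑ i, a i * (k i : ℂ)) • loopTensor x k b := by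
  simp only [derLoop, LinearMap.sum_apply, LinearMap.smulRight_apply, LinearMap.proj_apply,
    LinearMap.smul_apply, loopTensor, LinearMap.lTensor_tmul, LinearMap.rTensor_tmul,
    euler_monomial, ← TensorProduct.smul_tmul', TensorProduct.tmul_smul, Finset.sum_smul, mul_smul]

theorem derCentral_centralTensor (a : Fin (n + 1) → ℂ) (k : Fin (n + 1) → ℤ) (j : Fin (n + 1))
    (b : B) :
    derCentral a (centralTensor k j b) = (∑ i, a i * (k i : ℂ)) • centralTensor k j b := by
  simp only [derCentral, LinearMap.sum_apply, LinearMap.smulRight_apply, LinearMap.proj_apply,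
    LinearMap.smul_apply, centralTensor, LinearMap.rTensor_tmul, eulerZ_symbolK,
    TensorProduct.smul_tmul', Finset.sum_smul, mul_smul]

theorem sum_centralTensor_eq_zero (k : Fin (n + 1) → ℤ) (b : B) :
    ∑ i, (k i : ℂ) • centralTensor k i b = 0 := by
  simp only [centralTensor, TensorProduct.smul_tmul', ← TensorProduct.sum_tmul,
    sum_symbolK_eq_zero, TensorProduct.zero_tmul]

theorem loop_induction {p : LoopPart 𝔤 n B → Prop} (X : LoopPart 𝔤 n B) (zero : p 0)
    (add : ∀ X Y, p X → p Y → p (X + Y)) (tensor : ∀ x k b, p (loopTensor x k b)) : p X := by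
  induction X using TensorProduct.induction_on with
  | zero => exact zero
  | add X Y hX hY => exact add X Y hX hY
  | tmul x u =>
    induction u using TensorProduct.induction_on with
    | zero => simpa using zero
    | add u w hu hw => rw [TensorProduct.tmul_add]; exact add _ _ hu hw
    | tmul f b =>
      induction f using AddMonoidAlgebra.induction_linear with
      | zero => simpa using zero
      | add f g hf hg => rw [TensorProduct.add_tmul, TensorProduct.tmul_add]; exact add _ _ hf hg
      | single k c =>
        have h : (AddMonoidAlgebra.single k c : Laurent n) = c • monomial k := by
          simp [monomial]
        rw [h, TensorProduct.smul_tmul]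
        exact tensor x k (c • b)

theorem central_induction {p : CentralPart n B → Prop} (z : CentralPart n B) (zero : p 0)
    (add : ∀ z w, p z → p w → p (z + w)) (tensor : ∀ k i b, p (centralTensor k i b)) : p z := by
  induction z using TensorProduct.induction_on with
  | zero => exact zero
  | add z w hz hw => exact add z w hz hw
  | tmul ζ b =>
    obtain ⟨F, rfl⟩ := toZ_surjective ζ
    rw [← Finset.univ_sum_single F, map_sum, TensorProduct.sum_tmul]
    refine Finset.sum_induction _ p add zero fun i _ => ?_
    generalize F i = f
    induction f using AddMonoidAlgebra.induction_linear with
    | zero => simpa using zero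
    | add f g hf hg =>
      rw [Pi.single_add, map_add, TensorProduct.add_tmul]; exact add _ _ hf hg
    | single k c =>
      have h : (Pi.single i (AddMonoidAlgebra.single k c) : Omega n) = c • symbolK k i := by
        simp [symbolK, monomial, ← Pi.single_smul]
      rw [h, map_smul, TensorProduct.smul_tmul]
      exact tensor k i (c • b)

theorem eq_zero_of_eq_neg {W : Type*} [AddCommGroup W] [Module ℂ W] {w : W} (h : w = -w) :
    w = 0 := by
  have h2 : (2 : ℂ) • w = 0 := by rw [two_smul]; nth_rewrite 1 [h]; exact neg_add_cancel w
  exact (smul_eq_zero.1 h2).resolve_left two_ne_zero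

theorem loopBracket_skew (X Y : LoopPart 𝔤 n B) : loopBracket X Y = -loopBracket Y X := by
  induction X using loop_induction with
  | zero => simp
  | add X X' h h' => simp only [map_add, LinearMap.add_apply, h, h', neg_add]
  | tensor x k b =>
    induction Y using loop_induction with
    | zero => simp
    | add Y Y' h h' => simp only [map_add, LinearMap.add_apply, h, h', neg_add]
    | tensor y r c =>
      rw [loopBracket_loopTensor, loopBracket_loopTensor, ← lie_skew, add_comm k, mul_comm b]
      simp only [loopTensor, TensorProduct.neg_tmul]

theorem loopBracket_jacobi (X Y W : LoopPart 𝔤 n B) :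
    loopBracket X (loopBracket Y W) =
      loopBracket (loopBracket X Y) W + loopBracket Y (loopBracket X W) := by
  induction X using loop_induction with
  | zero => simp
  | add X X' h h' => simp only [map_add, LinearMap.add_apply, h, h']; abel
  | tensor x k b =>
    induction Y using loop_induction with
    | zero => simp
    | add Y Y' h h' => simp only [map_add, LinearMap.add_apply, h, h']; abel
    | tensor y r c =>
      induction W using loop_induction with
      | zero => simp
      | add W W' h h' => simp only [map_add, h, h']; abel
      | tensor w s e =>
        simp only [loopBracket_loopTensor]
        rw [leibniz_lie, add_left_comm r k s, mul_left_comm c b e, add_assoc, mul_assoc]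
        simp only [loopTensor, TensorProduct.add_tmul]

theorem derLoop_loopBracket (a : Fin (n + 1) → ℂ) (X Y : LoopPart 𝔤 n B) :
    derLoop a (loopBracket X Y) =
      loopBracket (derLoop a X) Y + loopBracket X (derLoop a Y) := by
  induction X using loop_induction with
  | zero => simp
  | add X X' h h' => simp only [map_add, LinearMap.add_apply, h, h']; abel
  | tensor x k b =>
    induction Y using loop_induction with
    | zero => simp
    | add Y Y' h h' => simp only [map_add, h, h']; abel
    | tensor y r c =>
      simp only [derLoop_loopTensor, loopBracket_loopTensor, map_smul, LinearMap.smul_apply,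
        ← add_smul, ← Finset.sum_add_distrib, ← mul_add, Pi.add_apply, Int.cast_add]

theorem derLoop_comm (a a' : Fin (n + 1) → ℂ) (X : LoopPart 𝔤 n B) :
    derLoop a (derLoop a' X) = derLoop a' (derLoop a X) := by
  induction X using loop_induction with
  | zero => simp
  | add X X' h h' => simp only [map_add, h, h']
  | tensor x k b => simp only [derLoop_loopTensor, map_smul]; rw [smul_comm]

theorem derCentral_comm (a a' : Fin (n + 1) → ℂ) (z : CentralPart n B) :
    derCentral a (derCentral a' z) = derCentral a' (derCentral a z) := by
  induction z using central_induction with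
  | zero => simp
  | add z z' h h' => simp only [map_add, h, h']
  | tensor k i b => simp only [derCentral_centralTensor, map_smul]; rw [smul_comm]

theorem derCentral_cocycle (Φ : LinearMap.BilinForm ℂ 𝔤) (a : Fin (n + 1) → ℂ)
    (X Y : LoopPart 𝔤 n B) :
    derCentral a (cocycle Φ X Y) = cocycle Φ (derLoop a X) Y + cocycle Φ X (derLoop a Y) := by
  induction X using loop_induction with
  | zero => simp
  | add X X' h h' => simp only [map_add, LinearMap.add_apply, h, h']; abel
  | tensor x k b =>
    induction Y using loop_induction with
    | zero => simp
    | add Y Y' h h' => simp only [map_add, h, h']; abel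
    | tensor y r c =>
      simp only [derLoop_loopTensor, cocycle_loopTensor, map_smul, LinearMap.smul_apply, map_sum,
        derCentral_centralTensor]
      have hS : ∑ j, a j * ((k + r) j : ℂ) = ∑ j, a j * (k j : ℂ) + ∑ j, a j * (r j : ℂ) := by
        simp only [← Finset.sum_add_distrib, ← mul_add, Pi.add_apply, Int.cast_add]
      rw [hS, ← add_smul, smul_comm _ (Φ x y)]
      generalize ∑ j, a j * (k j : ℂ) + ∑ j, a j * (r j : ℂ) = S
      simp only [smul_comm _ S, ← Finset.smul_sum]

theorem cocycle_skew {Φ : LinearMap.BilinForm ℂ 𝔤} (hs : ∀ x y, Φ x y = Φ y x)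
    (X Y : LoopPart 𝔤 n B) : cocycle Φ X Y = -cocycle Φ Y X := by
  induction X using loop_induction with
  | zero => simp
  | add X X' h h' => simp only [map_add, LinearMap.add_apply, h, h', neg_add]
  | tensor x k b =>
    induction Y using loop_induction with
    | zero => simp
    | add Y Y' h h' => simp only [map_add, LinearMap.add_apply, h, h', neg_add]
    | tensor y r c =>
      rw [cocycle_loopTensor, cocycle_loopTensor, hs y x, add_comm r k, mul_comm c b,
        eq_neg_iff_add_eq_zero, ← smul_add, ← Finset.sum_add_distrib]
      have h := sum_centralTensor_eq_zero (k + r) (b * c)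
      simp only [Pi.add_apply, Int.cast_add, add_smul] at h
      rw [h, smul_zero]

theorem cocycle_jacobi {Φ : LinearMap.BilinForm ℂ 𝔤}
    (hi : ∀ x y z, Φ ⁅x, y⁆ z = Φ x ⁅y, z⁆) (X Y W : LoopPart 𝔤 n B) :
    cocycle Φ X (loopBracket Y W) =
      cocycle Φ (loopBracket X Y) W + cocycle Φ Y (loopBracket X W) := by
  induction X using loop_induction with
  | zero => simp
  | add X X' h h' => simp only [map_add, LinearMap.add_apply, h, h']; abel
  | tensor x k b =>
    induction Y using loop_induction with
    | zero => simp
    | add Y Y' h h' => simp only [map_add, LinearMap.add_apply, h, h']; abel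
    | tensor y r c =>
      induction W using loop_induction with
      | zero => simp
      | add W W' h h' => simp only [map_add, h, h']; abel
      | tensor w s e =>
        simp only [loopBracket_loopTensor, cocycle_loopTensor]
        have e1 : Φ ⁅x, y⁆ w = Φ x ⁅y, w⁆ := hi x y w
        have e2 : Φ y ⁅x, w⁆ = -Φ x ⁅y, w⁆ := by
          rw [← hi y x w, ← lie_skew, map_neg, LinearMap.neg_apply, e1]
        rw [e1, e2, add_left_comm r k s, mul_left_comm c b e, add_assoc, mul_assoc,
          neg_smul (Φ x ⁅y, w⁆), ← smul_neg, ← smul_add, ← Finset.sum_neg_distrib, ← Finset.sum_add_distrib]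
        congr 1
        refine Finset.sum_congr rfl fun i _ => ?_
        simp [add_smul]

end Summands

/-! ### Roots, the maximal root, the normalized form -/

section Form

variable {𝔤 : Type*} [LieRing 𝔤] [LieAlgebra ℂ 𝔤] [FiniteDimensional ℂ 𝔤]
  [LieAlgebra.IsSimple ℂ 𝔤] {𝔥 : LieSubalgebra ℂ 𝔤} [𝔥.IsCartanSubalgebra]

/-- `β` is a maximal root for the order `λ ≤ μ ↔ μ - λ ∈ ∑ ℤ₊ α_i` given by a base. -/
def IsMaximalRoot (Δ : (LieAlgebra.IsKilling.rootSystem 𝔥).Base) (β : 𝔥.root) : Prop :=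
  ∀ γ : 𝔥.root,
    (LieAlgebra.IsKilling.rootSystem 𝔥).root γ - (LieAlgebra.IsKilling.rootSystem 𝔥).root β ∈
        AddSubmonoid.closure ((LieAlgebra.IsKilling.rootSystem 𝔥).root '' Δ.support) →
      γ = β

/-- The multiple of the Killing form normalized by `(β, β) = 2`. In terms of the coroot, whose
square length is `(β^∨, β^∨) = 4 / (β, β)`, the condition reads `(β^∨, β^∨) = 2`. -/
def normalizedForm (β : 𝔥.root) : LinearMap.BilinForm ℂ 𝔤 :=
  (2 / killingForm ℂ 𝔤 (LieAlgebra.IsKilling.coroot β.1 : 𝔤)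
    (LieAlgebra.IsKilling.coroot β.1 : 𝔤)) • killingForm ℂ 𝔤

theorem normalizedForm_symm (β : 𝔥.root) (x y : 𝔤) :
    normalizedForm β x y = normalizedForm β y x := by
  simp only [normalizedForm, LinearMap.smul_apply]
  exact congrArg _ (LieModule.traceForm_comm ℂ 𝔤 𝔤 x y)

theorem normalizedForm_invariant (β : 𝔥.root) (x y z : 𝔤) :
    normalizedForm β ⁅x, y⁆ z = normalizedForm β x ⁅y, z⁆ := by
  simp only [normalizedForm, LinearMap.smul_apply]
  exact congrArg _ (LieModule.traceForm_apply_lie_apply ℂ 𝔤 𝔤 x y z)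

end Form

/-! ### The loop toroidal Lie algebra -/

section Algebra

variable {𝔤 : Type*} [LieRing 𝔤] [LieAlgebra ℂ 𝔤] [FiniteDimensional ℂ 𝔤]
  [LieAlgebra.IsSimple ℂ 𝔤] {𝔥 : LieSubalgebra ℂ 𝔤} [𝔥.IsCartanSubalgebra]

/-- The loop toroidal Lie algebra `τ(B) = 𝔤 ⊗ A ⊗ B ⊕ Z ⊗ B ⊕ D`, where `D` has basis
`d_0, …, d_n`. The maximal root `β` enters through the normalization of the form in the bracket. -/
@[nolint unusedArguments]
def LoopToroidal (_β : 𝔥.root) (n : ℕ) (B : Type*) [CommRing B] [Algebra ℂ B] : Type _ :=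
  LoopPart 𝔤 n B × CentralPart n B × (Fin (n + 1) → ℂ)

namespace LoopToroidal

variable (β : 𝔥.root) (n : ℕ) (B : Type*) [CommRing B] [Algebra ℂ B]

instance : AddCommGroup (LoopToroidal β n B) :=
  inferInstanceAs (AddCommGroup (LoopPart 𝔤 n B × CentralPart n B × (Fin (n + 1) → ℂ)))

instance : Module ℂ (LoopToroidal β n B) :=
  inferInstanceAs (Module ℂ (LoopPart 𝔤 n B × CentralPart n B × (Fin (n + 1) → ℂ)))

variable {n B}

/-- The element with components `X ∈ 𝔤 ⊗ A ⊗ B`, `z ∈ Z ⊗ B` and `∑ i, a_i d_i ∈ D`. -/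
def mk (X : LoopPart 𝔤 n B) (z : CentralPart n B) (a : Fin (n + 1) → ℂ) : LoopToroidal β n B :=
  (X, z, a)

variable (n B) in
/-- The identification with the direct sum of the three parts, as vector spaces. -/
def equivProd : LoopToroidal β n B ≃ₗ[ℂ]
    LoopPart 𝔤 n B × CentralPart n B × (Fin (n + 1) → ℂ) :=
  LinearEquiv.refl ℂ _

instance : Bracket (LoopToroidal β n B) (LoopToroidal β n B) where
  bracket u v := mk β
    (loopBracket u.1 v.1 + derLoop u.2.2 v.1 - derLoop v.2.2 u.1)
    (cocycle (normalizedForm β) u.1 v.1 + derCentral u.2.2 v.2.1 - derCentral v.2.2 u.2.1)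
    0

theorem bracket_mk (X Y : LoopPart 𝔤 n B) (z w : CentralPart n B) (a c : Fin (n + 1) → ℂ) :
    ⁅mk β X z a, mk β Y w c⁆ = mk β
      (loopBracket X Y + derLoop a Y - derLoop c X)
      (cocycle (normalizedForm β) X Y + derCentral a w - derCentral c z) 0 := rfl

theorem mk_add_mk (X Y : LoopPart 𝔤 n B) (z w : CentralPart n B) (a c : Fin (n + 1) → ℂ) :
    mk β X z a + mk β Y w c = mk β (X + Y) (z + w) (a + c) := rfl

theorem smul_mk (s : ℂ) (X : LoopPart 𝔤 n B) (z : CentralPart n B) (a : Fin (n + 1) → ℂ) :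
    s • mk β X z a = mk β (s • X) (s • z) (s • a) := rfl

instance : LieRing (LoopToroidal β n B) where
  add_lie := by
    rintro ⟨X, z, a⟩ ⟨Y, w, c⟩ ⟨W, q, e⟩
    change ⁅mk β X z a + mk β Y w c, mk β W q e⁆ =
      ⁅mk β X z a, mk β W q e⁆ + ⁅mk β Y w c, mk β W q e⁆
    simp only [mk_add_mk, bracket_mk, map_add, LinearMap.add_apply, add_zero]
    congr 1 <;> abel
  lie_add := by
    rintro ⟨X, z, a⟩ ⟨Y, w, c⟩ ⟨W, q, e⟩
    change ⁅mk β X z a, mk β Y w c + mk β W q e⁆ =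
      ⁅mk β X z a, mk β Y w c⁆ + ⁅mk β X z a, mk β W q e⁆
    simp only [mk_add_mk, bracket_mk, map_add, LinearMap.add_apply, add_zero]
    congr 1 <;> abel
  lie_self := by
    rintro ⟨X, z, a⟩
    change ⁅mk β X z a, mk β X z a⁆ = mk β 0 0 0
    have h1 : loopBracket X X = 0 := eq_zero_of_eq_neg (loopBracket_skew X X)
    have h2 : cocycle (normalizedForm β) X X = 0 :=
      eq_zero_of_eq_neg (cocycle_skew (normalizedForm_symm β) X X)
    simp only [bracket_mk, h1, h2, zero_add, sub_self]
  leibniz_lie := by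
    rintro ⟨X, z, a⟩ ⟨Y, w, c⟩ ⟨W, q, e⟩
    change ⁅mk β X z a, ⁅mk β Y w c, mk β W q e⁆⁆ =
      ⁅⁅mk β X z a, mk β Y w c⁆, mk β W q e⁆ + ⁅mk β Y w c, ⁅mk β X z a, mk β W q e⁆⁆
    simp only [bracket_mk, mk_add_mk, map_add, map_sub, map_zero, LinearMap.add_apply,
      LinearMap.sub_apply, LinearMap.zero_apply, add_zero]
    congr 1
    · rw [loopBracket_jacobi X Y W, derLoop_loopBracket a, derLoop_loopBracket c,
        derLoop_loopBracket e, derLoop_comm a c, derLoop_comm a e, derLoop_comm c e,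
        loopBracket_skew Y (derLoop e X)]
      abel
    · rw [cocycle_jacobi (normalizedForm_invariant β) X Y W,
        derCentral_cocycle _ a, derCentral_cocycle _ c, derCentral_cocycle _ e,
        derCentral_comm a c, derCentral_comm a e, derCentral_comm c e,
        cocycle_skew (normalizedForm_symm β) Y (derLoop e X)]
      abel

instance : LieAlgebra ℂ (LoopToroidal β n B) where
  lie_smul := by
    rintro s ⟨X, z, a⟩ ⟨Y, w, c⟩
    change ⁅mk β X z a, s • mk β Y w c⁆ = s • ⁅mk β X z a, mk β Y w c⁆
    simp only [smul_mk, bracket_mk, map_smul, LinearMap.smul_apply, smul_add, smul_sub, smul_zero]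

/-- `x ⊗ t^k ⊗ b` as an element of `τ(B)`. -/
def loop (x : 𝔤) (k : Fin (n + 1) → ℤ) (b : B) : LoopToroidal β n B := mk β (loopTensor x k b) 0 0

/-- `t^k K_i ⊗ b` as an element of `τ(B)`. -/
def central (k : Fin (n + 1) → ℤ) (i : Fin (n + 1)) (b : B) : LoopToroidal β n B :=
  mk β 0 (centralTensor k i b) 0

variable (n B) in
/-- The derivation `d_i` as an element of `τ(B)`. -/
def der (i : Fin (n + 1)) : LoopToroidal β n B := mk β 0 0 (Pi.single i 1)

theorem loop_lie_loop (x y : 𝔤) (k r : Fin (n + 1) → ℤ) (b c : B) :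
    ⁅loop β x k b, loop β y r c⁆ = loop β ⁅x, y⁆ (k + r) (b * c) +
      normalizedForm β x y • ∑ i, (k i : ℂ) • central β (k + r) i (b * c) := by
  have h : normalizedForm β x y • ∑ i, (k i : ℂ) • central β (k + r) i (b * c) =
      mk β 0 (normalizedForm β x y • ∑ i, (k i : ℂ) • centralTensor (k + r) i (b * c)) 0 :=
    ((((equivProd β n B).symm.toLinearMap ∘ₗ LinearMap.inr ℂ _ _) ∘ₗ
      LinearMap.inl ℂ _ _).map_smul _ _ |>.trans (by simp only [map_sum, map_smul]; rfl)).symm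
  simp [h, loop, bracket_mk, mk_add_mk, loopBracket_loopTensor, cocycle_loopTensor]

theorem central_lie_loop (x : 𝔤) (k r : Fin (n + 1) → ℤ) (i : Fin (n + 1)) (b c : B) :
    ⁅central β k i b, loop β x r c⁆ = 0 := by
  simp only [central, loop, bracket_mk, map_zero, LinearMap.zero_apply, add_zero, sub_zero]
  rfl

theorem central_lie_central (k r : Fin (n + 1) → ℤ) (i j : Fin (n + 1)) (b c : B) :
    ⁅central β k i b, central β r j c⁆ = 0 := by
  simp only [central, bracket_mk, map_zero, LinearMap.zero_apply, add_zero, sub_zero]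
  rfl

theorem der_lie_loop (i : Fin (n + 1)) (x : 𝔤) (k : Fin (n + 1) → ℤ) (b : B) :
    ⁅der β n B i, loop β x k b⁆ = (k i : ℂ) • loop β x k b := by
  simp [der, loop, bracket_mk, smul_mk, derLoop_loopTensor, Pi.single_apply]

theorem der_lie_central (i : Fin (n + 1)) (k : Fin (n + 1) → ℤ) (j : Fin (n + 1)) (b : B) :
    ⁅der β n B i, central β k j b⁆ = (k i : ℂ) • central β k j b := by
  simp [der, central, bracket_mk, smul_mk, derCentral_centralTensor, Pi.single_apply]

theorem der_lie_der (i j : Fin (n + 1)) : ⁅der β n B i, der β n B j⁆ = 0 := by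
  simp only [der, bracket_mk, map_zero, add_zero, sub_zero]
  rfl

variable (n B) in
/-- `K_i = t^0 K_i ⊗ 1`. -/
def K (i : Fin (n + 1)) : LoopToroidal β n B := central β 0 i 1

end LoopToroidal

/-- The abelian Lie algebra `H = 𝔥 ⊕ (⊕ ℂ K_i) ⊕ (⊕ ℂ d_i)`, in coordinates with respect to the
`K_i` and the `d_i`. -/
abbrev CartanH (𝔥 : LieSubalgebra ℂ 𝔤) (n : ℕ) : Type _ :=
  𝔥 × (Fin (n + 1) → ℂ) × (Fin (n + 1) → ℂ)

open LoopToroidal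

/-- The inclusion of `H` in `τ(B)`, which sends `h ∈ 𝔥` to `h ⊗ 1 ⊗ 1`, the basis vector `K_i` to
`K_i ⊗ 1` and `d_i` to `d_i`. -/
def cartanIncl (β : 𝔥.root) (n : ℕ) (B : Type*) [CommRing B] [Algebra ℂ B] (h : CartanH 𝔥 n) :
    LoopToroidal β n B :=
  loop β (h.1 : 𝔤) 0 1 + ∑ i, h.2.1 i • K β n B i + ∑ i, h.2.2 i • der β n B i

/-- `𝔤⁺`, the sum of the root spaces of the positive roots. -/
def positivePart (Δ : (LieAlgebra.IsKilling.rootSystem 𝔥).Base) : Submodule ℂ 𝔤 :=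
  ⨆ α : 𝔥.root, ⨆ _ : Δ.IsPos α, (LieAlgebra.rootSpace 𝔥 α.1).toSubmodule

/-- `τ(B)⁺ = 𝔤⁺ ⊗ ℂ[t₁^±1, …, t_n^±1] ⊗ B ⊕ 𝔤 ⊗ t₀ℂ[t₀, t₁^±1, …, t_n^±1] ⊗ B ⊕
⊕_i t₀ℂ[t₀, t₁^±1, …, t_n^±1] K_i ⊗ B`. -/
def toroidalPlus (Δ : (LieAlgebra.IsKilling.rootSystem 𝔥).Base) (β : 𝔥.root) (n : ℕ)
    (B : Type*) [CommRing B] [Algebra ℂ B] : Submodule ℂ (LoopToroidal β n B) :=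
  Submodule.span ℂ
    ({u | ∃ x ∈ positivePart Δ, ∃ k : Fin (n + 1) → ℤ, ∃ b : B, k 0 = 0 ∧ u = loop β x k b} ∪
      {u | ∃ x : 𝔤, ∃ k : Fin (n + 1) → ℤ, ∃ b : B, 0 < k 0 ∧ u = loop β x k b} ∪
      {u | ∃ (i : Fin (n + 1)) (k : Fin (n + 1) → ℤ) (b : B), 0 < k 0 ∧ u = central β k i b})

/-- The coroot `γ^∨ = α^∨ + 2 / (α, α) ∑ i, m_i K_i ∈ H` of the real root
`γ = α + ∑ i, m_i δ_i`, where `2 / (α, α) = (α^∨, α^∨) / 2`. -/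
def realCoroot (β : 𝔥.root) {n : ℕ} (α : LieModule.Weight ℂ 𝔥 𝔤) (m : Fin (n + 1) → ℤ) :
    CartanH 𝔥 n :=
  (LieAlgebra.IsKilling.coroot α,
    fun i => normalizedForm β (LieAlgebra.IsKilling.coroot α : 𝔤)
      (LieAlgebra.IsKilling.coroot α : 𝔤) / 2 * (m i : ℂ),
    0)

/-- `lam ∈ H^*` is dominant integral for the affine algebra
`𝔤 ⊗ ℂ[t₀^±1] ⊕ ℂ K₀ ⊕ ℂ d₀`: it takes non-negative integral values on the coroots of the simple
roots `α_1, …, α_d` and `α_0 = δ_0 - β`. -/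
def IsAffineDominantIntegral (Δ : (LieAlgebra.IsKilling.rootSystem 𝔥).Base) (β : 𝔥.root) {n : ℕ}
    (lam : Module.Dual ℂ (CartanH 𝔥 n)) : Prop :=
  (∀ α ∈ Δ.support, ∃ N : ℕ, lam (realCoroot β α.1 0) = N) ∧
    ∃ N : ℕ, lam (realCoroot β (-β.1) (Pi.single 0 1)) = N

end Algebra

/-! ### Modules -/

section Modules

variable {𝔤 : Type*} [LieRing 𝔤] [LieAlgebra ℂ 𝔤] [FiniteDimensional ℂ 𝔤]
  [LieAlgebra.IsSimple ℂ 𝔤] {𝔥 : LieSubalgebra ℂ 𝔤} [𝔥.IsCartanSubalgebra]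
  (β : 𝔥.root) (n : ℕ) (B : Type*) [CommRing B] [Algebra ℂ B]
  (V : Type*) [AddCommGroup V] [Module ℂ V] [LieRingModule (LoopToroidal β n B) V]
  [LieModule ℂ (LoopToroidal β n B) V]

/-- The weight space `V_lam = {v | h v = lam(h) v for all h ∈ H}`. -/
def weightSpace (lam : Module.Dual ℂ (CartanH 𝔥 n)) : Submodule ℂ V where
  carrier := {v | ∀ h : CartanH 𝔥 n, ⁅cartanIncl β n B h, v⁆ = lam h • v}
  add_mem' hv hw h := by rw [lie_add, hv h, hw h, smul_add]
  zero_mem' h := by simp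
  smul_mem' c v hv h := by rw [lie_smul, hv h, smul_comm]

/-- Integrable modules: `V` is the direct sum of its weight spaces, and each `X_α ⊗ t^k ⊗ b`, with
`X_α` in the root space of a root `α` of `𝔤`, is locally nilpotent on `V`. -/
structure IsIntegrable : Prop where
  iSupIndep_weightSpace : iSupIndep (weightSpace β n B V)
  iSup_weightSpace : ⨆ lam, weightSpace β n B V lam = ⊤
  locally_nilpotent : ∀ α : 𝔥.root, ∀ x ∈ LieAlgebra.rootSpace 𝔥 α.1,
    ∀ (k : Fin (n + 1) → ℤ) (b : B) (v : V), ∃ N : ℕ,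
      ((LieModule.toEnd ℂ (LoopToroidal β n B) V (LoopToroidal.loop β x k b)) ^ N) v = 0

end Modules

end Toroidal

end

/-!
The root vectors of a real root `γ = α + ∑ i, m_i δ_i` and of `-γ` generate a locally nilpotent
`sl₂`, so weights of `V` take integral values on the coroot `γ^∨`, and if `lam(γ^∨) > 0` then a
root vector of `-γ` is injective on `V_lam` (`exists_injOn_weightSpace`). Since `K_0` acts as
`c₀ > 0` and the other `K_i` by zero, the number `lam(γ^∨) = lam(α^∨) + 2 / (α, α) m_0 c₀` depends
on the `m_i` only through `m_0`, and grows with it.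

Fix a weight `lam`. If `m_0` is large, two such injections, for real roots with finite parts `β` and
`-β`, lead from the weight `lam + ∑ i, m_i δ_i` back to `lam`. Hence the weight spaces of all these
weights have dimension at most `D = dim V_lam` (`finrank_add_rootWeight_le`). On the other hand the
elements `β^∨ ⊗ t_0^j` with `j = ±1, ±2` span, with the centre, a Heisenberg algebra with non-zero
central charge: starting from a common eigenvector of the two number operators, one of the two
generators of each pair can be applied indefinitely, the vectors obtained are separated by the
number operators, and `D + 1` of them lie in a single weight space at most `2 D` steps away
(`Heisenberg.exists_lt_finrank`). So there are no weights `lam + ∑ i, m_i δ_i` with `m_0` large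
(`exists_forall_le_of_rootWeight_zero`).

If a weight is large on some `α^∨`, it is positive on the coroot of `α - δ_0`, so subtracting
`α - δ_0` gives another weight, with a larger `d_0`-degree and a shorter finite part. The process
ends in a finite set of finite parts; this bounds the degree of all weights, and shows that the
weights of maximal degree have finitely many finite parts (`exists_maximal_degree`). A weight of
maximal degree, and then of maximal height, is a highest weight. Conversely, a highest weight vector
is a primitive vector for the `sl₂` of each simple affine root, whence dominance.
-/

set_option linter.unusedSectionVars false

open scoped TensorProduct

noncomputable section

/-! ### Locally nilpotent `sl₂`-triples -/

namespace IsSl2Triple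

variable {L M : Type*} [LieRing L] [LieAlgebra ℂ L] [AddCommGroup M] [Module ℂ M]
  [LieRingModule L M] [LieModule ℂ L M] {h e f : L}

theorem HasPrimitiveVectorWith.exists_nat_of_toEnd_pow_eq_zero {t : IsSl2Triple h e f} {m : M}
    {μ : ℂ} (P : t.HasPrimitiveVectorWith m μ) {N : ℕ}
    (hN : ((LieModule.toEnd ℂ L M f) ^ N) m = 0) : ∃ n : ℕ, μ = n := by
  obtain ⟨n, hn₁, hn₂⟩ := Nat.exists_not_and_succ_of_not_zero_of_exists
    (p := fun N => ((LieModule.toEnd ℂ L M f) ^ N) m = 0) P.ne_zero ⟨N, hN⟩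
  refine ⟨n, ?_⟩
  have h := P.lie_e_pow_succ_toEnd_f n
  rw [hn₂, lie_zero, eq_comm, smul_eq_zero_iff_left hn₁, mul_eq_zero, sub_eq_zero] at h
  exact h.resolve_left (Nat.cast_add_one_ne_zero n)

theorem exists_int_of_locally_nilpotent (t : IsSl2Triple h e f) {m : M} (hm : m ≠ 0) {μ : ℂ}
    (hμ : ⁅h, m⁆ = μ • m) (he : ∀ w : M, ∃ N, ((LieModule.toEnd ℂ L M e) ^ N) w = 0)
    (hf : ∀ w : M, ∃ N, ((LieModule.toEnd ℂ L M f) ^ N) w = 0) : ∃ z : ℤ, μ = z := by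
  obtain ⟨j, hj₁, hj₂⟩ := Nat.exists_not_and_succ_of_not_zero_of_exists
    (p := fun N => ((LieModule.toEnd ℂ L M e) ^ N) m = 0) hm (he m)
  have hw : ∀ j : ℕ, ⁅h, ((LieModule.toEnd ℂ L M e) ^ j) m⁆ =
      (μ + 2 * j) • ((LieModule.toEnd ℂ L M e) ^ j) m := by
    intro j
    induction j with
    | zero => simpa using hμ
    | succ j ih =>
      rw [pow_succ', Module.End.mul_apply, LieModule.toEnd_apply_apply, leibniz_lie,
        t.lie_h_e_smul ℂ, ih, lie_smul, smul_lie, ← add_smul]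
      congr 1
      push_cast
      ring
  have P : t.HasPrimitiveVectorWith (((LieModule.toEnd ℂ L M e) ^ j) m) (μ + 2 * j) :=
    ⟨hj₁, hw j, by rwa [pow_succ', Module.End.mul_apply] at hj₂⟩
  obtain ⟨N, hN⟩ := hf (((LieModule.toEnd ℂ L M e) ^ j) m)
  obtain ⟨n, hn⟩ := P.exists_nat_of_toEnd_pow_eq_zero hN
  exact ⟨n - 2 * j, by push_cast; rw [← hn]; ring⟩

/-- The lowering operator of a locally nilpotent `sl₂`-triple is injective in positive weight. -/
theorem eq_zero_of_lie_f_eq_zero (t : IsSl2Triple h e f) {m : M} {z : ℤ} (hz : 0 < z)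
    (hμ : ⁅h, m⁆ = (z : ℂ) • m) (he : ∃ N, ((LieModule.toEnd ℂ L M e) ^ N) m = 0)
    (hf : ⁅f, m⁆ = 0) : m = 0 := by
  by_contra hm
  have P : t.symm.HasPrimitiveVectorWith m (-z : ℂ) := ⟨hm, by simp [hμ], hf⟩
  obtain ⟨N, hN⟩ := he
  obtain ⟨n, hn⟩ := P.exists_nat_of_toEnd_pow_eq_zero hN
  have : -z = (n : ℤ) := by exact_mod_cast hn
  omega

end IsSl2Triple

/-! ### Graded modules over a Heisenberg algebra of rank two -/

namespace Heisenberg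

variable {V : Type*} [AddCommGroup V] [Module ℂ V]

theorem exists_eigenvector_of_mapsTo (N : Module.End ℂ V) (W : Submodule ℂ V)
    [FiniteDimensional ℂ W] (hW : W ≠ ⊥) (hN : ∀ w ∈ W, N w ∈ W) :
    ∃ ν : ℂ, ∃ v ∈ W, v ≠ 0 ∧ N v = ν • v := by
  have : Nontrivial W := (Submodule.nontrivial_iff_ne_bot).2 hW
  obtain ⟨ν, hν⟩ := Module.End.exists_eigenvalue (N.restrict hN)
  obtain ⟨v, hv⟩ := hν.exists_hasEigenvector
  refine ⟨ν, v, v.2, by simpa using hv.2, ?_⟩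
  simpa using congrArg Subtype.val hv.apply_eq_smul

theorem exists_common_eigenvector {N₁ N₂ : Module.End ℂ V} (hc : Commute N₁ N₂)
    (W : Submodule ℂ V) [FiniteDimensional ℂ W] (hW : W ≠ ⊥) (h₁ : ∀ w ∈ W, N₁ w ∈ W)
    (h₂ : ∀ w ∈ W, N₂ w ∈ W) :
    ∃ ν₁ ν₂ : ℂ, ∃ v ∈ W, v ≠ 0 ∧ N₁ v = ν₁ • v ∧ N₂ v = ν₂ • v := by
  obtain ⟨ν₁, v, hv, hv0, hν⟩ := exists_eigenvector_of_mapsTo N₁ W hW h₁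
  have hfin : FiniteDimensional ℂ (W ⊓ N₁.eigenspace ν₁ : Submodule ℂ V) :=
    Submodule.finiteDimensional_of_le inf_le_left
  have hmem : v ∈ W ⊓ N₁.eigenspace ν₁ := ⟨hv, Module.End.mem_eigenspace_iff.2 hν⟩
  obtain ⟨ν₂, w, hw, hw0, hν₂⟩ := exists_eigenvector_of_mapsTo N₂ (W ⊓ N₁.eigenspace ν₁)
    (fun hbot => hv0 (by simpa [hbot] using hmem)) (by
      rintro w ⟨hw, hw'⟩
      refine ⟨h₂ w hw, ?_⟩
      rw [SetLike.mem_coe, Module.End.mem_eigenspace_iff] at hw' ⊢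
      rw [← Module.End.mul_apply, hc.eq, Module.End.mul_apply, hw', map_smul])
  exact ⟨ν₁, ν₂, w, hw.1, hw0, Module.End.mem_eigenspace_iff.1 hw.2, hν₂⟩

variable {a b : Module.End ℂ V} {c : ℂ}

theorem mul_apply_pow_left (hab : a * b = b * a + c • 1) {ν : ℂ} {v : V}
    (hv : (a * b) v = ν • v) (x : ℕ) : (a * b) ((a ^ x) v) = (ν - x * c) • (a ^ x) v := by
  induction x with
  | zero => simpa using hv
  | succ x ih =>
    have h : (b * a) ((a ^ x) v) = (ν - x * c - c) • (a ^ x) v := by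
      rw [eq_sub_of_add_eq hab.symm, LinearMap.sub_apply, ih, sub_smul _ c]
      simp
    rw [pow_succ', Module.End.mul_apply a (a ^ x), ← Module.End.mul_apply (a * b), mul_assoc,
      Module.End.mul_apply, h, map_smul]
    congr 1
    push_cast
    ring

theorem mul_apply_pow_right (hab : a * b = b * a + c • 1) {ν : ℂ} {v : V}
    (hv : (a * b) v = ν • v) (x : ℕ) : (a * b) ((b ^ x) v) = (ν + x * c) • (b ^ x) v := by
  induction x with
  | zero => simpa using hv
  | succ x ih =>
    have h : (a * b) (b ((b ^ x) v)) = b ((a * b) ((b ^ x) v)) + c • b ((b ^ x) v) := by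
      simpa using LinearMap.congr_fun hab (b ((b ^ x) v))
    rw [pow_succ', Module.End.mul_apply b (b ^ x), h, ih, map_smul, ← add_smul]
    congr 1
    push_cast
    ring

/-- If `[a, b] = c ≠ 0`, then all powers of `a`, or all powers of `b`, are non-zero on the
eigenvectors of `a b` with a given eigenvalue `ν`. The sign `s` is the degree of the operator `u`
that is chosen, when `a` has degree `1` and `b` has degree `-1`. -/
theorem exists_pow_ne_zero (hc : c ≠ 0) (hab : a * b = b * a + c • 1) (ν : ℂ) :
    ∃ (s : ℤ) (u : Module.End ℂ V), (s = 1 ∧ u = a ∨ s = -1 ∧ u = b) ∧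
      ∀ v : V, v ≠ 0 → (a * b) v = ν • v → ∀ x : ℕ,
        (u ^ x) v ≠ 0 ∧ (a * b) ((u ^ x) v) = (ν - s * x * c) • (u ^ x) v := by
  by_cases h : ∃ y : ℕ, ν = (y + 1) * c
  · -- The eigenvalue `ν + x c` of `a b` on `b ^ x v` is a positive multiple of `c`.
    obtain ⟨y, rfl⟩ := h
    refine ⟨-1, b, Or.inr ⟨rfl, rfl⟩, fun v hv hν x => ⟨?_, ?_⟩⟩
    · induction x with
      | zero => simpa using hv
      | succ x ih =>
        intro h0
        have h := mul_apply_pow_right hab hν x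
        rw [pow_succ', Module.End.mul_apply] at h0
        rw [Module.End.mul_apply, h0, map_zero, eq_comm, smul_eq_zero] at h
        refine ih (h.resolve_left ?_)
        rw [← add_mul]
        refine mul_ne_zero ?_ hc
        exact_mod_cast (by omega : y + 1 + x ≠ 0)
    · rw [mul_apply_pow_right hab hν x]
      congr 1
      push_cast
      ring
  · -- The eigenvalue `ν - (x + 1) c` of `b a` on `a ^ x v` never vanishes.
    refine ⟨1, a, Or.inl ⟨rfl, rfl⟩, fun v hv hν x => ⟨?_, ?_⟩⟩
    · induction x with
      | zero => simpa using hv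
      | succ x ih =>
        intro h0
        have h' := mul_apply_pow_left hab hν x
        rw [pow_succ', Module.End.mul_apply] at h0
        rw [hab, LinearMap.add_apply, Module.End.mul_apply, h0, map_zero, zero_add,
          LinearMap.smul_apply, Module.End.one_apply, ← sub_eq_zero, ← sub_smul,
          smul_eq_zero] at h'
        refine h ⟨x, ?_⟩
        linear_combination (-1 : ℂ) * h'.resolve_right ih
    · rw [mul_apply_pow_left hab hν x]
      congr 1
      push_cast
      ring

theorem pow_apply_mem {W : ℤ → Submodule ℂ V} {u : Module.End ℂ V} {d : ℤ}
    (hu : ∀ m, ∀ w ∈ W m, u w ∈ W (m + d)) (x : ℕ) {m : ℤ} {w : V} (hw : w ∈ W m) :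
    (u ^ x) w ∈ W (m + x * d) := by
  induction x with
  | zero => simpa using hw
  | succ x ih =>
    rw [pow_succ', Module.End.mul_apply]
    convert hu _ _ ih using 2
    push_cast
    ring

/-- A graded module with finite-dimensional pieces over a Heisenberg algebra with non-zero central
charge and with two pairs of generators, of degrees `± 1` and `± 2`, has pieces of dimension larger
than any given `D`, at a distance at most `2 D` from any non-zero piece. -/
theorem exists_lt_finrank (W : ℤ → Submodule ℂ V) [∀ m, FiniteDimensional ℂ (W m)]
    {a₁ b₁ a₂ b₂ : Module.End ℂ V} {c₁ c₂ : ℂ} (hc₁ : c₁ ≠ 0) (hc₂ : c₂ ≠ 0)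
    (h₁ : a₁ * b₁ = b₁ * a₁ + c₁ • 1) (h₂ : a₂ * b₂ = b₂ * a₂ + c₂ • 1)
    (haa : Commute a₁ a₂) (hab : Commute a₁ b₂) (hba : Commute b₁ a₂) (hbb : Commute b₁ b₂)
    (ha₁ : ∀ m, ∀ w ∈ W m, a₁ w ∈ W (m + 1)) (hb₁ : ∀ m, ∀ w ∈ W m, b₁ w ∈ W (m + -1))
    (ha₂ : ∀ m, ∀ w ∈ W m, a₂ w ∈ W (m + 2)) (hb₂ : ∀ m, ∀ w ∈ W m, b₂ w ∈ W (m + -2))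
    {m : ℤ} (hm : W m ≠ ⊥) (D : ℕ) :
    ∃ m' : ℤ, m - 2 * D ≤ m' ∧ D < Module.finrank ℂ (W m') := by
  obtain ⟨ν₁, ν₂, v, hv, hv0, hν₁, hν₂⟩ := exists_common_eigenvector
    (N₁ := a₁ * b₁) (N₂ := a₂ * b₂) (((haa.mul_right hab)).mul_left (hba.mul_right hbb)) (W m) hm
    (fun w hw => by simpa using ha₁ _ _ (hb₁ _ _ hw))
    (fun w hw => by simpa using ha₂ _ _ (hb₂ _ _ hw))
  obtain ⟨s₁, u₁, hs₁, hu₁⟩ := exists_pow_ne_zero hc₁ h₁ ν₁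
  obtain ⟨s₂, u₂, hs₂, hu₂⟩ := exists_pow_ne_zero hc₂ h₂ ν₂
  have hcomm : Commute (a₂ * b₂) u₁ := by
    rcases hs₁ with ⟨-, rfl⟩ | ⟨-, rfl⟩
    · exact (haa.mul_right hab).symm
    · exact (hba.mul_right hbb).symm
  have hcomm' : Commute (a₁ * b₁) u₂ := by
    rcases hs₂ with ⟨-, rfl⟩ | ⟨-, rfl⟩
    · exact haa.mul_left hba
    · exact hab.mul_left hbb
  have hd₁ : ∀ m, ∀ w ∈ W m, u₁ w ∈ W (m + s₁) := by
    rcases hs₁ with ⟨rfl, rfl⟩ | ⟨rfl, rfl⟩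
    · exact ha₁
    · exact hb₁
  have hd₂ : ∀ m, ∀ w ∈ W m, u₂ w ∈ W (m + 2 * s₂) := by
    rcases hs₂ with ⟨rfl, rfl⟩ | ⟨rfl, rfl⟩
    · exact ha₂
    · exact hb₂
  -- The vectors `u₁ ^ x u₂ ^ i v`, with `x` chosen so that they all have the same degree, are
  -- eigenvectors of `a₂ b₂` with distinct eigenvalues.
  obtain ⟨x, e, he, hx⟩ : ∃ (x : ℕ → ℕ) (e : ℤ), -(2 * D : ℤ) ≤ e ∧
      ∀ i ≤ D, (i : ℤ) * (2 * s₂) + x i * s₁ = e := by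
    have hs : s₁ = s₂ ∨ s₁ = -s₂ := by omega
    rcases hs with rfl | rfl
    · refine ⟨fun i => 2 * (D - i), 2 * D * s₁, ?_, fun i hi => ?_⟩
      · rcases hs₁ with ⟨rfl, -⟩ | ⟨rfl, -⟩ <;> omega
      · push_cast [hi]
        ring
    · exact ⟨fun i => 2 * i, 0, by omega, fun i _ => by push_cast; ring⟩
  refine ⟨m + e, by omega, ?_⟩
  let w : Fin (D + 1) → V := fun i => (u₁ ^ x i) ((u₂ ^ (i : ℕ)) v)
  have hw : ∀ i, w i ∈ W (m + e) := fun i => by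
    have := pow_apply_mem hd₁ (x i) (pow_apply_mem hd₂ (i : ℕ) hv)
    rwa [add_assoc, hx i (by omega)] at this
  have hlin : LinearIndependent ℂ w := by
    refine Module.End.eigenvectors_linearIndependent' (a₂ * b₂)
      (fun i : Fin (D + 1) => ν₂ - s₂ * (i : ℕ) * c₂) ?_ w fun i => ?_
    · intro i j hij
      have hs : (s₂ : ℂ) ≠ 0 := by
        rcases hs₂ with ⟨rfl, -⟩ | ⟨rfl, -⟩ <;> simp
      have := sub_right_injective hij
      have := mul_right_cancel₀ hc₂ this
      have := mul_left_cancel₀ hs this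
      exact Fin.ext (by exact_mod_cast this)
    · obtain ⟨hne, heig⟩ := hu₂ v hv0 hν₂ i
      rw [Module.End.hasEigenvector_iff, Module.End.mem_eigenspace_iff]
      refine ⟨?_, (hu₁ _ hne ?_ _).1⟩
      · rw [← Module.End.mul_apply, (hcomm.pow_right (x i)).eq, Module.End.mul_apply, heig,
          map_smul]
      · rw [← Module.End.mul_apply, (hcomm'.pow_right _).eq, Module.End.mul_apply, hν₁, map_smul]
  have hlin' : LinearIndependent ℂ (fun i => (⟨w i, hw i⟩ : W (m + e))) :=
    LinearIndependent.of_comp (W (m + e)).subtype hlin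
  simpa using hlin'.fintype_card_le_finrank

end Heisenberg

namespace Toroidal

open LoopToroidal LieAlgebra.IsKilling

variable {𝔤 : Type*} [LieRing 𝔤] [LieAlgebra ℂ 𝔤] [FiniteDimensional ℂ 𝔤]
  [LieAlgebra.IsSimple ℂ 𝔤] {𝔥 : LieSubalgebra ℂ 𝔤} [𝔥.IsCartanSubalgebra]

/-! ### The normalized form on coroots -/

/-- The root `-α`. -/
def negRoot (α : 𝔥.root) : 𝔥.root :=
  ⟨-α.1, by simpa [LieSubalgebra.root] using LieSubalgebra.isNonZero_coe_root α⟩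

theorem killingForm_coroot (α γ : 𝔥.root) :
    killingForm ℂ 𝔤 (coroot α.1 : 𝔤) (coroot γ.1 : 𝔤) =
      ∑ δ : 𝔥.root, δ.1 (coroot α.1) * δ.1 (coroot γ.1) := by
  have h := LinearMap.congr_fun₂ (corootForm_rootSystem_eq_killing (K := ℂ) (H := 𝔥))
    (coroot α.1) (coroot γ.1)
  rw [RootPairing.corootForm_apply_apply] at h
  exact h.symm

theorem exists_killingForm_coroot_self (α : 𝔥.root) :
    ∃ N : ℕ, 0 < N ∧ killingForm ℂ 𝔤 (coroot α.1 : 𝔤) (coroot α.1 : 𝔤) = N := by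
  have hα : α.1.IsNonZero := LieSubalgebra.isNonZero_coe_root α
  refine ⟨(∑ δ : 𝔥.root, ((LieModule.chainBotCoeff α.1 δ.1 : ℤ) -
    LieModule.chainTopCoeff α.1 δ.1) ^ 2).toNat, ?_, ?_⟩
  · rw [Int.lt_toNat, Nat.cast_zero]
    refine Finset.sum_pos' (fun _ _ => sq_nonneg _) ⟨α, Finset.mem_univ _, ?_⟩
    have h := apply_coroot_eq_cast α.1 α.1
    rw [root_apply_coroot hα] at h
    have h' : (LieModule.chainBotCoeff α.1 α.1 : ℤ) - LieModule.chainTopCoeff α.1 α.1 = 2 := by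
      exact_mod_cast h.symm
    rw [h']
    norm_num
  · rw [killingForm_coroot, ← Int.cast_natCast, Int.toNat_of_nonneg
      (Finset.sum_nonneg fun _ _ => sq_nonneg _), Int.cast_sum]
    refine Finset.sum_congr rfl fun δ _ => ?_
    rw [apply_coroot_eq_cast α.1 δ.1]
    push_cast
    ring

theorem exists_normalizedForm_coroot_self (β α : 𝔥.root) :
    ∃ r : ℝ, normalizedForm β (coroot α.1 : 𝔤) (coroot α.1 : 𝔤) / 2 = r := by
  obtain ⟨N, -, h⟩ := exists_killingForm_coroot_self β
  obtain ⟨M, -, h'⟩ := exists_killingForm_coroot_self α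
  refine ⟨M / N, ?_⟩
  simp only [normalizedForm, LinearMap.smul_apply, h, h', smul_eq_mul]
  push_cast
  ring

theorem normalizedForm_coroot_self (β : 𝔥.root) :
    normalizedForm β (coroot β.1 : 𝔤) (coroot β.1 : 𝔤) = 2 := by
  obtain ⟨N, hN, h⟩ := exists_killingForm_coroot_self β
  simp only [normalizedForm, LinearMap.smul_apply, h, smul_eq_mul]
  exact div_mul_cancel₀ _ (by exact_mod_cast hN.ne')

/-! ### Root vectors of `τ(B)` -/

section RootVectors

variable {n : ℕ} {B : Type*} [CommRing B] [Algebra ℂ B]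

/-- The element `q + ∑ i, k_i δ_i` of `H^*`, which vanishes on the `K_i`. -/
def rootWeight (q : Module.Dual ℂ 𝔥) (k : Fin (n + 1) → ℤ) : Module.Dual ℂ (CartanH 𝔥 n) :=
  q ∘ₗ LinearMap.fst ℂ _ _ +
    ∑ i, (k i : ℂ) • (LinearMap.proj i ∘ₗ LinearMap.snd ℂ _ _ ∘ₗ LinearMap.snd ℂ _ _)

theorem rootWeight_apply (q : Module.Dual ℂ 𝔥) (k : Fin (n + 1) → ℤ) (h : CartanH 𝔥 n) :
    rootWeight q k h = q h.1 + ∑ i, (k i : ℂ) * h.2.2 i := by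
  simp [rootWeight, LinearMap.sum_apply]

theorem rootWeight_add (q q' : Module.Dual ℂ 𝔥) (k k' : Fin (n + 1) → ℤ) :
    rootWeight (q + q') (k + k') = rootWeight q k + rootWeight q' k' := by
  refine LinearMap.ext fun h => ?_
  simp only [LinearMap.add_apply, rootWeight_apply, Pi.add_apply, Int.cast_add, add_mul,
    Finset.sum_add_distrib]
  ring

theorem rootWeight_zero : rootWeight (0 : Module.Dual ℂ 𝔥) (0 : Fin (n + 1) → ℤ) = 0 := by
  exact LinearMap.ext fun h => by simp [rootWeight_apply]

theorem rootWeight_sub (q q' : Module.Dual ℂ 𝔥) (k k' : Fin (n + 1) → ℤ) :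
    rootWeight (q - q') (k - k') = rootWeight q k - rootWeight q' k' := by
  rw [eq_sub_iff_add_eq, ← rootWeight_add, sub_add_cancel, sub_add_cancel]

theorem rootWeight_neg (q : Module.Dual ℂ 𝔥) (k : Fin (n + 1) → ℤ) :
    rootWeight (-q) (-k) = -rootWeight q k := by
  rw [← zero_sub, ← zero_sub, rootWeight_sub, rootWeight_zero, zero_sub]

theorem rootWeight_realCoroot (β : 𝔥.root) (q : Module.Dual ℂ 𝔥) (k m : Fin (n + 1) → ℤ)
    (α : LieModule.Weight ℂ 𝔥 𝔤) : rootWeight q k (realCoroot β α m) = q (coroot α) := by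
  simp [rootWeight_apply, realCoroot]

variable (β : 𝔥.root)

theorem loop_add (x y : 𝔤) (k : Fin (n + 1) → ℤ) (b : B) :
    loop β (x + y) k b = loop β x k b + loop β y k b := by
  simp [loop, mk_add_mk, loopTensor, TensorProduct.add_tmul]

theorem loop_smul (c : ℂ) (x : 𝔤) (k : Fin (n + 1) → ℤ) (b : B) :
    loop β (c • x) k b = c • loop β x k b := by
  simp [loop, smul_mk, loopTensor, TensorProduct.smul_tmul']

theorem loop_zero (k : Fin (n + 1) → ℤ) (b : B) : loop β (0 : 𝔤) k b = 0 := by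
  simpa using loop_smul β 0 (0 : 𝔤) k b

theorem cartanIncl_lie_loop {q : Module.Dual ℂ 𝔥} {x : 𝔤}
    (hx : x ∈ LieAlgebra.rootSpace 𝔥 q) (k : Fin (n + 1) → ℤ) (b : B) (h : CartanH 𝔥 n) :
    ⁅cartanIncl β n B h, loop β x k b⁆ = rootWeight q k h • loop β x k b := by
  have hx' : ⁅(h.1 : 𝔤), x⁆ = q h.1 • x := lie_eq_smul_of_mem_rootSpace hx h.1
  simp only [cartanIncl, add_lie, sum_lie, smul_lie, loop_lie_loop, hx', loop_smul, K,
    central_lie_loop, der_lie_loop, rootWeight_apply, add_smul, Finset.sum_smul, smul_smul]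
  simp [mul_comm]

theorem cartanIncl_lie_central (k : Fin (n + 1) → ℤ) (j : Fin (n + 1)) (b : B)
    (h : CartanH 𝔥 n) :
    ⁅cartanIncl β n B h, central β k j b⁆ =
      rootWeight (0 : Module.Dual ℂ 𝔥) k h • central β k j b := by
  have h0 : ⁅loop β (h.1 : 𝔤) (0 : Fin (n + 1) → ℤ) (1 : B), central β k j b⁆ = 0 := by
    rw [← lie_skew, central_lie_loop, neg_zero]
  simp only [cartanIncl, add_lie, sum_lie, smul_lie, h0, K, central_lie_central, der_lie_central,
    rootWeight_apply, smul_smul]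
  simp [mul_comm, Finset.sum_smul]

/-- The elements `X_α ⊗ t^m` and `X_{-α} ⊗ t^{-m}`, for suitable root vectors, form an `sl₂`-triple
with the coroot of the real root `α + ∑ i, m_i δ_i`. The coroot vanishes only if `B = 0`. -/
theorem exists_isSl2Triple (α : 𝔥.root) (m : Fin (n + 1) → ℤ)
    (hne : cartanIncl β n B (realCoroot β α.1 m) ≠ 0) :
    ∃ x ∈ LieAlgebra.rootSpace 𝔥 α.1, ∃ y ∈ LieAlgebra.rootSpace 𝔥 (-α.1 : LieModule.Weight ℂ 𝔥 𝔤),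
      IsSl2Triple (cartanIncl β n B (realCoroot β α.1 m)) (loop β x m 1) (loop β y (-m) 1) := by
  have hα : α.1.IsNonZero := LieSubalgebra.isNonZero_coe_root α
  obtain ⟨h, x, y, t, hx, hy⟩ := exists_isSl2Triple_of_weight_isNonZero hα
  obtain rfl : h = coroot α.1 := t.h_eq_coroot hα hx hy
  have hform : normalizedForm β x y =
      normalizedForm β (coroot α.1 : 𝔤) (coroot α.1 : 𝔤) / 2 := by
    have h1 := normalizedForm_invariant β x y (coroot α.1 : 𝔤)
    have h2 : ⁅y, (coroot α.1 : 𝔤)⁆ = (2 : ℂ) • y := by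
      rw [← lie_skew, t.lie_lie_smul_f ℂ, neg_neg]
    rw [t.lie_e_f, h2, map_smul, smul_eq_mul] at h1
    rw [h1, mul_div_cancel_left₀ _ two_ne_zero]
  have hxα : x ∈ LieAlgebra.rootSpace 𝔥 (α.1.toLinear : Module.Dual ℂ 𝔥) := hx
  have hyα : y ∈ LieAlgebra.rootSpace 𝔥 ((-α.1.toLinear : Module.Dual ℂ 𝔥)) := hy
  refine ⟨x, hx, y, hy, hne, ?_, ?_, ?_⟩
  · rw [loop_lie_loop, t.lie_e_f, add_neg_cancel, mul_one, hform]
    simp [cartanIncl, realCoroot, K, Finset.smul_sum, smul_smul]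
  · rw [cartanIncl_lie_loop β hxα, rootWeight_realCoroot]
    simp [root_apply_coroot hα, two_smul]
  · rw [cartanIncl_lie_loop β hyα, rootWeight_realCoroot]
    simp [root_apply_coroot hα, two_smul]

end RootVectors

/-! ### Weights of integrable modules -/

section Weights

variable {β : 𝔥.root} {n : ℕ} {B : Type*} [CommRing B] [Algebra ℂ B]
  {V : Type*} [AddCommGroup V] [Module ℂ V] [LieRingModule (LoopToroidal β n B) V]
  [LieModule ℂ (LoopToroidal β n B) V]

theorem lie_mem_weightSpace {u : LoopToroidal β n B} {η lam : Module.Dual ℂ (CartanH 𝔥 n)}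
    (hu : ∀ h, ⁅cartanIncl β n B h, u⁆ = η h • u) {v : V} (hv : v ∈ weightSpace β n B V lam) :
    ⁅u, v⁆ ∈ weightSpace β n B V (lam + η) := fun h => by
  rw [leibniz_lie, hu, hv h, smul_lie, lie_smul, ← add_smul, LinearMap.add_apply, add_comm]

theorem loop_lie_mem_weightSpace {q : Module.Dual ℂ 𝔥} {x : 𝔤} (hx : x ∈ LieAlgebra.rootSpace 𝔥 q)
    (k : Fin (n + 1) → ℤ) (b : B) {lam : Module.Dual ℂ (CartanH 𝔥 n)} {v : V}
    (hv : v ∈ weightSpace β n B V lam) :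
    ⁅loop β x k b, v⁆ ∈ weightSpace β n B V (lam + rootWeight q k) :=
  lie_mem_weightSpace (cartanIncl_lie_loop β hx k b) hv

theorem exists_int_apply_realCoroot (hint : IsIntegrable β n B V)
    {lam : Module.Dual ℂ (CartanH 𝔥 n)} (hlam : weightSpace β n B V lam ≠ ⊥) (α : 𝔥.root)
    (m : Fin (n + 1) → ℤ) : ∃ z : ℤ, lam (realCoroot β α.1 m) = z := by
  obtain ⟨v, hv, hv0⟩ := (Submodule.ne_bot_iff _).1 hlam
  by_cases hne : cartanIncl β n B (realCoroot β α.1 m) = 0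
  · have h := hv (realCoroot β α.1 m)
    rw [hne, zero_lie, eq_comm, smul_eq_zero] at h
    exact ⟨0, by simpa using h.resolve_right hv0⟩
  · obtain ⟨x, hx, y, hy, t⟩ := exists_isSl2Triple β α m hne
    exact t.exists_int_of_locally_nilpotent hv0 (hv _) (hint.locally_nilpotent α x hx m 1)
      (hint.locally_nilpotent (negRoot α) y hy (-m) 1)

/-- If the weight `lam` is positive on the coroot of the real root `γ`, then a root vector of `-γ`
is injective on the weight space of `lam`. -/
theorem exists_injOn_weightSpace (hint : IsIntegrable β n B V)
    {lam : Module.Dual ℂ (CartanH 𝔥 n)} (α : 𝔥.root) (m : Fin (n + 1) → ℤ) {z : ℤ} (hz : 0 < z)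
    (hlam : lam (realCoroot β α.1 m) = z) :
    ∃ F : V →ₗ[ℂ] V, ∀ v ∈ weightSpace β n B V lam,
      F v ∈ weightSpace β n B V (lam - rootWeight α.1.toLinear m) ∧ (F v = 0 → v = 0) := by
  by_cases hne : cartanIncl β n B (realCoroot β α.1 m) = 0
  · refine ⟨0, fun v hv => ⟨zero_mem _, fun _ => ?_⟩⟩
    have h := hv (realCoroot β α.1 m)
    rw [hne, zero_lie, hlam, eq_comm, smul_eq_zero] at h
    exact h.resolve_left (by exact_mod_cast hz.ne')
  · obtain ⟨x, hx, y, hy, t⟩ := exists_isSl2Triple β α m hne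
    refine ⟨LieModule.toEnd ℂ (LoopToroidal β n B) V (loop β y (-m) 1), fun v hv => ⟨?_, fun h => ?_⟩⟩
    · have hy' : y ∈ LieAlgebra.rootSpace 𝔥 (-α.1.toLinear : Module.Dual ℂ 𝔥) := hy
      have h := loop_lie_mem_weightSpace hy' (-m) (1 : B) hv
      rwa [rootWeight_neg, ← sub_eq_add_neg] at h
    · exact t.eq_zero_of_lie_f_eq_zero hz (hlam ▸ hv (realCoroot β α.1 m))
        (hint.locally_nilpotent α x hx m 1 v) h

theorem weightSpace_sub_ne_bot (hint : IsIntegrable β n B V)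
    {lam : Module.Dual ℂ (CartanH 𝔥 n)} (hV : weightSpace β n B V lam ≠ ⊥) (α : 𝔥.root)
    (m : Fin (n + 1) → ℤ) {z : ℤ} (hz : 0 < z) (hlam : lam (realCoroot β α.1 m) = z) :
    weightSpace β n B V (lam - rootWeight α.1.toLinear m) ≠ ⊥ := by
  obtain ⟨v, hv, hv0⟩ := (Submodule.ne_bot_iff _).1 hV
  obtain ⟨F, hF⟩ := exists_injOn_weightSpace hint α m hz hlam
  exact (Submodule.ne_bot_iff _).2 ⟨F v, (hF v hv).1, fun h => hv0 ((hF v hv).2 h)⟩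

theorem finrank_weightSpace_le (hint : IsIntegrable β n B V)
    (hfin : ∀ lam : Module.Dual ℂ (CartanH 𝔥 n), FiniteDimensional ℂ (weightSpace β n B V lam))
    (lam : Module.Dual ℂ (CartanH 𝔥 n)) (α : 𝔥.root)
    (m : Fin (n + 1) → ℤ) {z : ℤ} (hz : 0 < z) (hlam : lam (realCoroot β α.1 m) = z) :
    Module.finrank ℂ (weightSpace β n B V lam) ≤
      Module.finrank ℂ (weightSpace β n B V (lam - rootWeight α.1.toLinear m)) := by
  obtain ⟨F, hF⟩ := exists_injOn_weightSpace hint α m hz hlam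
  have := hfin (lam - rootWeight α.1.toLinear m)
  refine LinearMap.finrank_le_finrank_of_injective (f := F.restrict fun v hv => (hF v hv).1) ?_
  rw [injective_iff_map_eq_zero]
  intro v hv
  exact Subtype.ext ((hF v v.2).2 (congrArg Subtype.val hv))

theorem apply_realCoroot {c : ℂ} (hK₀ : ∀ v : V, ⁅K β n B 0, v⁆ = c • v)
    (hK : ∀ i : Fin (n + 1), i ≠ 0 → ∀ v : V, ⁅K β n B i, v⁆ = 0)
    {lam : Module.Dual ℂ (CartanH 𝔥 n)} (hV : weightSpace β n B V lam ≠ ⊥) (α : 𝔥.root)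
    (m : Fin (n + 1) → ℤ) :
    lam (realCoroot β α.1 m) = lam (realCoroot β α.1 0) +
      normalizedForm β (coroot α.1 : 𝔤) (coroot α.1 : 𝔤) / 2 * (m 0 : ℂ) * c := by
  obtain ⟨v, hv, hv0⟩ := (Submodule.ne_bot_iff _).1 hV
  have hloop : loop β (0 : 𝔤) (0 : Fin (n + 1) → ℤ) (1 : B) = 0 := loop_zero β _ _
  set p := normalizedForm β (coroot α.1 : 𝔤) (coroot α.1 : 𝔤) / 2
  have h := hv (0, fun i => p * m i, 0)
  have h' : ⁅cartanIncl β n B (0, fun i => p * (m i : ℂ), 0), v⁆ = (p * m 0 * c) • v := by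
    simp only [cartanIncl, ZeroMemClass.coe_zero, hloop, zero_add, Pi.zero_apply, zero_smul,
      Finset.sum_const_zero, add_zero, sum_lie, smul_lie]
    rw [Finset.sum_eq_single 0 (fun i _ hi => by rw [hK i hi, smul_zero]) (by simp), hK₀,
      smul_smul]
  rw [h'] at h
  have h3 := smul_left_injective ℂ hv0 h
  rw [h3, ← map_add]
  congr 1
  simp [realCoroot, p]
  rfl

end Weights

/-! ### Weights are bounded above along imaginary roots -/

section Imaginary

variable (β : 𝔥.root) (n : ℕ) (B : Type*) [CommRing B] [Algebra ℂ B]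
  (V : Type*) [AddCommGroup V] [Module ℂ V] [LieRingModule (LoopToroidal β n B) V]
  [LieModule ℂ (LoopToroidal β n B) V]

variable {n B} in
theorem central_single_eq_zero {j : ℤ} (hj : j ≠ 0) (b : B) :
    central β (Pi.single (0 : Fin (n + 1)) j) 0 b = 0 := by
  have h := sum_centralTensor_eq_zero (Pi.single (0 : Fin (n + 1)) j) b
  rw [Finset.sum_eq_single 0 (by intro i _ hi; simp [hi]) (by simp), Pi.single_eq_same,
    smul_eq_zero] at h
  rw [central, h.resolve_left (by exact_mod_cast hj)]
  rfl

/-- The action of `β^∨ ⊗ t₀^j`; for `j ≠ 0` these operators span, with the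
identity, a Heisenberg algebra when `K_0` acts as a non-zero scalar. -/
def heisenbergOp (j : ℤ) : Module.End ℂ V :=
  LieModule.toEnd ℂ (LoopToroidal β n B) V (loop β (coroot β.1 : 𝔤) (Pi.single 0 j) 1)

theorem heisenbergOp_bracket (j l : ℤ) :
    heisenbergOp β n B V j * heisenbergOp β n B V l =
      heisenbergOp β n B V l * heisenbergOp β n B V j + (2 * j : ℂ) •
        LieModule.toEnd ℂ (LoopToroidal β n B) V (central β (Pi.single 0 (j + l)) 0 1) := by
  have h : ⁅loop β (coroot β.1 : 𝔤) (Pi.single (0 : Fin (n + 1)) j) (1 : B),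
      loop β (coroot β.1 : 𝔤) (Pi.single (0 : Fin (n + 1)) l) (1 : B)⁆ =
        (2 * j : ℂ) • central β (Pi.single 0 (j + l)) 0 (1 : B) := by
    rw [loop_lie_loop, lie_self, loop_zero, zero_add, normalizedForm_coroot_self,
      Finset.sum_eq_single 0 (by intro i _ hi; simp [hi]) (by simp), Pi.single_eq_same, smul_smul,
      mul_one, ← Pi.single_add]
  refine LinearMap.ext fun v => ?_
  have h' := leibniz_lie (loop β (coroot β.1 : 𝔤) (Pi.single (0 : Fin (n + 1)) j) (1 : B))
    (loop β (coroot β.1 : 𝔤) (Pi.single (0 : Fin (n + 1)) l) (1 : B)) v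
  rw [h, smul_lie] at h'
  exact h'.trans (add_comm _ _)

theorem heisenbergOp_commute {j l : ℤ} (h : j + l ≠ 0) :
    Commute (heisenbergOp β n B V j) (heisenbergOp β n B V l) := by
  have := heisenbergOp_bracket β n B V j l
  rwa [central_single_eq_zero β h, map_zero, smul_zero, add_zero] at this

variable {β n B V}

theorem heisenbergOp_mul_neg {c : ℂ} (hK₀ : ∀ v : V, ⁅K β n B 0, v⁆ = c • v) (j : ℤ) :
    heisenbergOp β n B V j * heisenbergOp β n B V (-j) =
      heisenbergOp β n B V (-j) * heisenbergOp β n B V j + (2 * j * c : ℂ) • 1 := by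
  have h : LieModule.toEnd ℂ (LoopToroidal β n B) V (central β 0 0 1) = c • 1 :=
    LinearMap.ext hK₀
  rw [heisenbergOp_bracket, add_neg_cancel, Pi.single_zero, h, smul_smul]

theorem heisenbergOp_mem_weightSpace (j : ℤ) {lam : Module.Dual ℂ (CartanH 𝔥 n)} {v : V}
    (hv : v ∈ weightSpace β n B V lam) : heisenbergOp β n B V j v ∈
      weightSpace β n B V (lam + rootWeight (0 : Module.Dual ℂ 𝔥) (Pi.single 0 j)) := by
  refine loop_lie_mem_weightSpace ?_ _ _ hv
  have h : (coroot β.1 : 𝔤) ∈ LieAlgebra.rootSpace 𝔥 (0 : 𝔥 → ℂ) := by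
    simp
  exact h

/-- Far from `lam` in the direction of `δ₀`, weight spaces have at most the dimension of `V_lam`:
two injective root vectors, for real roots with finite parts `β` and `-β`, lead back to `lam`. -/
theorem finrank_add_rootWeight_le (hint : IsIntegrable β n B V)
    (hfin : ∀ lam : Module.Dual ℂ (CartanH 𝔥 n), FiniteDimensional ℂ (weightSpace β n B V lam))
    {c : ℕ} (hc : 0 < c) (hK₀ : ∀ v : V, ⁅K β n B 0, v⁆ = (c : ℂ) • v)
    (hK : ∀ i : Fin (n + 1), i ≠ 0 → ∀ v : V, ⁅K β n B i, v⁆ = 0)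
    {lam : Module.Dual ℂ (CartanH 𝔥 n)} {l : ℤ} (hl : lam (realCoroot β β.1 0) = l)
    {k : Fin (n + 1) → ℤ} (hk : 2 * |l| + 1 ≤ k 0) :
    Module.finrank ℂ (weightSpace β n B V (lam + rootWeight 0 k)) ≤
      Module.finrank ℂ (weightSpace β n B V lam) := by
  by_cases hV : weightSpace β n B V (lam + rootWeight 0 k) = ⊥
  · rw [hV, finrank_bot]
    exact Nat.zero_le _
  have hp : normalizedForm β (coroot β.1 : 𝔤) (coroot β.1 : 𝔤) / 2 = 1 := by
    rw [normalizedForm_coroot_self, div_self two_ne_zero]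
  have hp' : normalizedForm β (coroot (negRoot β).1 : 𝔤) (coroot (negRoot β).1 : 𝔤) / 2 = 1 := by
    simpa [negRoot] using hp
  have hβ : (β.1.toLinear : Module.Dual ℂ 𝔥) (coroot β.1) = 2 :=
    root_apply_coroot (LieSubalgebra.isNonZero_coe_root β)
  have hneg : realCoroot β (negRoot β).1 (0 : Fin (n + 1) → ℤ) = -realCoroot β β.1 0 := by
    ext <;> simp [realCoroot, negRoot]
  obtain ⟨j, hj⟩ : ∃ j, j = k 0 - |l| - 1 := ⟨_, rfl⟩
  have hc' : (1 : ℤ) ≤ c := by exact_mod_cast hc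
  have hl₁ := neg_abs_le l
  have hl₂ := le_abs_self l
  have hl₀ := abs_nonneg l
  have hz₁ : (0 : ℤ) < l + (k 0 - j) * c := by nlinarith
  have hz₂ : (0 : ℤ) < 2 - l + j * c := by nlinarith
  have h₁ : (lam + rootWeight 0 k : Module.Dual ℂ (CartanH 𝔥 n))
      (realCoroot β β.1 (k - Pi.single 0 j)) =
      (l + (k 0 - j) * c : ℤ) := by
    rw [apply_realCoroot hK₀ hK hV, hp, LinearMap.add_apply, hl, rootWeight_realCoroot]
    simp
  have hV' := weightSpace_sub_ne_bot hint hV β _ hz₁ h₁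
  have h₂ : (lam + rootWeight 0 k - rootWeight β.1.toLinear (k - Pi.single 0 j) :
      Module.Dual ℂ (CartanH 𝔥 n))
      (realCoroot β (negRoot β).1 (Pi.single 0 j)) = (2 - l + j * c : ℤ) := by
    rw [apply_realCoroot hK₀ hK hV', hp', hneg, map_neg, LinearMap.sub_apply,
      LinearMap.add_apply, hl, rootWeight_realCoroot, rootWeight_realCoroot, hβ]
    simp
  refine (finrank_weightSpace_le hint hfin _ β _ hz₁ h₁).trans
    ((finrank_weightSpace_le hint hfin _ (negRoot β) _ hz₂ h₂).trans (le_of_eq ?_))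
  have hlam : lam + rootWeight 0 k - rootWeight β.1.toLinear (k - Pi.single 0 j) -
      rootWeight (negRoot β).1.toLinear (Pi.single 0 j) = lam := by
    have h : rootWeight (β.1.toLinear + (negRoot β).1.toLinear)
        ((k - Pi.single 0 j) + Pi.single 0 j) = rootWeight 0 k := by
      rw [sub_add_cancel]
      congr 1
      simp [negRoot]
    rw [rootWeight_add] at h
    rw [sub_sub, h, add_sub_cancel_right]
  rw [hlam]

/-- The weights of the form `lam + ∑ i, k_i δ_i` have bounded `k_0`, uniformly in `k_1, …, k_n`. -/
theorem exists_forall_le_of_rootWeight_zero (hint : IsIntegrable β n B V)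
    (hfin : ∀ lam : Module.Dual ℂ (CartanH 𝔥 n), FiniteDimensional ℂ (weightSpace β n B V lam))
    {c : ℕ} (hc : 0 < c) (hK₀ : ∀ v : V, ⁅K β n B 0, v⁆ = (c : ℂ) • v)
    (hK : ∀ i : Fin (n + 1), i ≠ 0 → ∀ v : V, ⁅K β n B i, v⁆ = 0)
    {lam : Module.Dual ℂ (CartanH 𝔥 n)} (hV : weightSpace β n B V lam ≠ ⊥) :
    ∃ M : ℤ, ∀ k, weightSpace β n B V (lam + rootWeight 0 k) ≠ ⊥ → k 0 ≤ M := by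
  obtain ⟨l, hl⟩ := exists_int_apply_realCoroot hint hV β 0
  refine ⟨2 * |l| + 1 + 2 * Module.finrank ℂ (weightSpace β n B V lam), fun k hk => ?_⟩
  by_contra! hlt
  let W : ℤ → Submodule ℂ V := fun m =>
    weightSpace β n B V (lam + rootWeight 0 (k + Pi.single 0 m))
  have hWfin : ∀ m, FiniteDimensional ℂ (W m) := fun m => hfin _
  have hop : ∀ j m : ℤ, ∀ w ∈ W m, heisenbergOp β n B V j w ∈ W (m + j) := by
    intro j m w hw
    have h := heisenbergOp_mem_weightSpace j hw
    rwa [add_assoc, ← rootWeight_add, add_zero, add_assoc, ← Pi.single_add] at h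
  have hc' : (c : ℂ) ≠ 0 := by exact_mod_cast hc.ne'
  have hc₁ : 2 * ((1 : ℤ) : ℂ) * c ≠ 0 := by simpa using hc'
  have hc₂ : 2 * ((2 : ℤ) : ℂ) * c ≠ 0 := by simpa using hc'
  have hcomm : ∀ {j l : ℤ}, j + l ≠ 0 →
      Commute (heisenbergOp β n B V j) (heisenbergOp β n B V l) := heisenbergOp_commute β n B V
  obtain ⟨m, hm, hD⟩ := Heisenberg.exists_lt_finrank W (m := 0)
    (a₁ := heisenbergOp β n B V 1) (b₁ := heisenbergOp β n B V (-1))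
    (a₂ := heisenbergOp β n B V 2) (b₂ := heisenbergOp β n B V (-2)) hc₁ hc₂
    (heisenbergOp_mul_neg hK₀ 1) (heisenbergOp_mul_neg hK₀ 2)
    (hcomm (by norm_num)) (hcomm (by norm_num)) (hcomm (by norm_num)) (hcomm (by norm_num))
    (hop 1) (hop (-1)) (hop 2) (hop (-2)) (by simpa [W] using hk)
    (Module.finrank ℂ (weightSpace β n B V lam))
  have hk' : 2 * |l| + 1 ≤ (k + Pi.single 0 m : Fin (n + 1) → ℤ) 0 := by
    rw [Pi.add_apply, Pi.single_eq_same]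
    linarith
  exact absurd (finrank_add_rootWeight_le hint hfin hc hK₀ hK hl hk') (not_le.2 hD)

end Imaginary

/-! ### Weights of maximal degree -/

theorem finite_setOf_coroot_bounded (T : ℤ) :
    {q : Module.Dual ℂ 𝔥 | ∀ α : 𝔥.root, ∃ z : ℤ, |z| ≤ T ∧ q (coroot α.1) = z}.Finite := by
  have hinj : Function.Injective fun (q : Module.Dual ℂ 𝔥) (α : 𝔥.root) => q (coroot α.1) := by
    intro q q' h
    refine LinearMap.ext_on_range
      (RootPairing.IsRootSystem.span_coroot_eq_top (P := rootSystem 𝔥)) fun α => ?_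
    exact congrFun h α
  refine Set.Finite.subset (Set.Finite.preimage hinj.injOn
    (Set.Finite.pi' fun _ : 𝔥.root => (Set.finite_Icc (-T) T).image fun z : ℤ => (z : ℂ))) ?_
  intro q hq α
  obtain ⟨z, hz, h⟩ := hq α
  exact ⟨z, abs_le.1 hz, h.symm⟩

theorem rootForm_sub_root (q : Module.Dual ℂ 𝔥) (α : 𝔥.root) :
    (rootSystem 𝔥).RootForm (q - α.1.toLinear) (q - α.1.toLinear) =
      (rootSystem 𝔥).RootForm q q +
        (rootSystem 𝔥).RootForm α.1.toLinear α.1.toLinear * (1 - q (coroot α.1)) := by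
  have h := congrArg q ((rootSystem 𝔥).rootForm_self_smul_coroot α)
  have h' := (rootSystem 𝔥).toLinearMap_apply_apply_Polarization ((rootSystem 𝔥).root α) q
  have hs : (rootSystem 𝔥).RootForm q α.1.toLinear = (rootSystem 𝔥).RootForm α.1.toLinear q :=
    (rootSystem 𝔥).rootForm_symmetric.eq _ _
  rw [rootSystem_toLinearMap_apply] at h'
  rw [map_smul, map_nsmul, h'] at h
  simp only [rootSystem_root_apply, rootSystem_coroot_apply, smul_eq_mul, nsmul_eq_mul,
    Nat.cast_ofNat] at h
  simp only [map_sub, LinearMap.sub_apply, hs]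
  linear_combination h

theorem exists_nat_rootForm {q : Module.Dual ℂ 𝔥}
    (hq : ∀ α : 𝔥.root, ∃ z : ℤ, q (coroot α.1) = z) :
    ∃ N : ℕ, (rootSystem 𝔥).RootForm q q = N := by
  choose z hz using hq
  refine ⟨(∑ α : 𝔥.root, z α ^ 2).toNat, ?_⟩
  rw [← Int.cast_natCast, Int.toNat_of_nonneg (Finset.sum_nonneg fun _ _ => sq_nonneg _),
    RootPairing.rootForm_apply_apply, Int.cast_sum]
  refine Finset.sum_congr rfl fun α _ => ?_
  have h : (rootSystem 𝔥).coroot' α q = z α := hz α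
  rw [h]
  push_cast
  ring

theorem exists_nat_rootForm_root (α : 𝔥.root) :
    ∃ N : ℕ, 0 < N ∧ (rootSystem 𝔥).RootForm α.1.toLinear α.1.toLinear = N := by
  obtain ⟨N, hN⟩ := exists_nat_rootForm (q := α.1.toLinear) fun γ =>
    ⟨_, apply_coroot_eq_cast γ.1 α.1⟩
  refine ⟨N, Nat.pos_of_ne_zero ?_, hN⟩
  rintro rfl
  exact RootPairing.IsAnisotropic.rootForm_root_ne_zero (P := rootSystem 𝔥) α (by simpa using hN)

/-- A linear functional that extends the height of roots. -/
theorem exists_dual_eq_height (Δ : (rootSystem 𝔥).Base) :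
    ∃ f : Module.Dual ℂ 𝔥 →ₗ[ℂ] ℂ, ∀ α : 𝔥.root, f α.1.toLinear = Δ.height α := by
  refine ⟨Δ.toWeightBasis.constr ℂ fun _ => 1, fun α => ?_⟩
  obtain ⟨g, -, -, hg⟩ := Δ.exists_root_eq_sum_int α
  rw [RootPairing.Base.height_eq_sum hg]
  have h : ∀ j ∈ Δ.support, (Δ.toWeightBasis.constr ℂ fun _ => (1 : ℂ))
      ((rootSystem 𝔥).root j) = 1 := fun j hj => by
    have := Δ.toWeightBasis.constr_basis ℂ (fun _ => (1 : ℂ)) ⟨j, hj⟩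
    rwa [Δ.toWeightBasis_apply] at this
  rw [rootSystem_root_apply] at hg
  rw [hg, map_sum, Int.cast_sum]
  refine Finset.sum_congr rfl fun j hj => ?_
  rw [map_zsmul, h j hj]
  simp

section Maximal

variable {β : 𝔥.root} {n : ℕ} {B : Type*} [CommRing B] [Algebra ℂ B]
  {V : Type*} [AddCommGroup V] [Module ℂ V] [LieRingModule (LoopToroidal β n B) V]
  [LieModule ℂ (LoopToroidal β n B) V]

/-- The restriction of a weight to `𝔥`. -/
def finitePart (lam : Module.Dual ℂ (CartanH 𝔥 n)) : Module.Dual ℂ 𝔥 :=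
  lam ∘ₗ LinearMap.inl ℂ _ _

theorem finitePart_add_rootWeight (lam : Module.Dual ℂ (CartanH 𝔥 n)) (q : Module.Dual ℂ 𝔥)
    (k : Fin (n + 1) → ℤ) : finitePart (lam + rootWeight q k) = finitePart lam + q :=
  LinearMap.ext fun h => by simp [finitePart, rootWeight_apply]

variable (β) in
theorem finitePart_coroot (lam : Module.Dual ℂ (CartanH 𝔥 n)) (α : 𝔥.root) :
    finitePart lam (coroot α.1) = lam (realCoroot β α.1 0) := by
  have h : realCoroot β α.1 (0 : Fin (n + 1) → ℤ) = (coroot α.1, 0, 0) := by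
    ext <;> simp [realCoroot]
  rw [h]
  rfl

theorem exists_int_finitePart_coroot (hint : IsIntegrable β n B V)
    {lam : Module.Dual ℂ (CartanH 𝔥 n)} (hV : weightSpace β n B V lam ≠ ⊥) (α : 𝔥.root) :
    ∃ z : ℤ, finitePart lam (coroot α.1) = z := by
  rw [finitePart_coroot β]
  exact exists_int_apply_realCoroot hint hV α 0

/-- If the finite part of a weight is large on the coroot of `α`, then it is positive on the coroot
of `α - δ₀`, and subtracting that root gives a weight of higher degree. -/
theorem weightSpace_sub_root_add_ne_bot (hint : IsIntegrable β n B V)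
    {c : ℕ} (hK₀ : ∀ v : V, ⁅K β n B 0, v⁆ = (c : ℂ) • v)
    (hK : ∀ i : Fin (n + 1), i ≠ 0 → ∀ v : V, ⁅K β n B i, v⁆ = 0)
    {lam : Module.Dual ℂ (CartanH 𝔥 n)} {q : Module.Dual ℂ 𝔥} {k : Fin (n + 1) → ℤ}
    (hV : weightSpace β n B V (lam + rootWeight q k) ≠ ⊥) (α : 𝔥.root) {r : ℝ}
    (hr : normalizedForm β (coroot α.1 : 𝔤) (coroot α.1 : 𝔤) / 2 = r) {z : ℤ} (hz : r * c < z)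
    (hq : (finitePart lam + q) (coroot α.1) = z) :
    weightSpace β n B V (lam + rootWeight (q - α.1.toLinear) (k + Pi.single 0 1)) ≠ ⊥ := by
  obtain ⟨y, hy⟩ := exists_int_apply_realCoroot hint hV α (-Pi.single 0 1)
  have hy' := hy
  rw [apply_realCoroot hK₀ hK hV, hr, ← finitePart_coroot β, finitePart_add_rootWeight, hq] at hy'
  have hy0 : 0 < y := by
    have h : (z : ℝ) - r * c = y := by
      apply Complex.ofReal_injective
      push_cast
      rw [← hy']
      simp
      ring
    have : (0 : ℝ) < y := by linarith
    exact_mod_cast this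
  have h := weightSpace_sub_ne_bot hint hV α _ hy0 hy
  rwa [add_sub_assoc, ← rootWeight_sub, sub_neg_eq_add] at h

/-- The degrees `k_0` of the weights `lam + q + ∑ i, k_i δ_i` are bounded above, and the weights of
maximal degree have finitely many finite parts. -/
theorem exists_maximal_degree (hint : IsIntegrable β n B V)
    (hfin : ∀ lam : Module.Dual ℂ (CartanH 𝔥 n), FiniteDimensional ℂ (weightSpace β n B V lam))
    {c : ℕ} (hc : 0 < c) (hK₀ : ∀ v : V, ⁅K β n B 0, v⁆ = (c : ℂ) • v)
    (hK : ∀ i : Fin (n + 1), i ≠ 0 → ∀ v : V, ⁅K β n B i, v⁆ = 0)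
    {lam : Module.Dual ℂ (CartanH 𝔥 n)} (hlam : weightSpace β n B V lam ≠ ⊥) :
    ∃ s : ℤ, (∀ q k, weightSpace β n B V (lam + rootWeight q k) ≠ ⊥ → k 0 ≤ s) ∧
      {q | ∃ k, k 0 = s ∧ weightSpace β n B V (lam + rootWeight q k) ≠ ⊥}.Nonempty ∧
      {q | ∃ k, k 0 = s ∧ weightSpace β n B V (lam + rootWeight q k) ≠ ⊥}.Finite := by
  choose r hr using exists_normalizedForm_coroot_self (𝔥 := 𝔥) β
  obtain ⟨T, hT1, hT⟩ : ∃ T : ℤ, 1 ≤ T ∧ ∀ α, r α * c ≤ T := by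
    obtain ⟨M, hM⟩ := (Set.finite_range fun α => r α * (c : ℝ)).bddAbove
    refine ⟨max 1 ⌈M⌉, le_max_left _ _, fun α => (hM ⟨α, rfl⟩).trans ((Int.le_ceil M).trans ?_)⟩
    exact_mod_cast le_max_right _ _
  -- The finite parts that are not large on any coroot.
  let F : Set (Module.Dual ℂ 𝔥) := {q | ∀ α : 𝔥.root, ∃ z : ℤ, |z| ≤ T ∧
    (finitePart lam + q) (coroot α.1) = z}
  have hF : F.Finite :=
    (finite_setOf_coroot_bounded T).preimage (add_right_injective (finitePart lam)).injOn
  have hmove : ∀ q k, weightSpace β n B V (lam + rootWeight q k) ≠ ⊥ → q ∈ F ∨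
      ∃ α : 𝔥.root, ∃ z : ℤ, T < z ∧ (finitePart lam + q) (coroot α.1) = z ∧
        weightSpace β n B V (lam + rootWeight (q - α.1.toLinear) (k + Pi.single 0 1)) ≠ ⊥ := by
    intro q k hV
    have hint' : ∀ α : 𝔥.root, ∃ z : ℤ, (finitePart lam + q) (coroot α.1) = z := fun α => by
      rw [← finitePart_add_rootWeight lam q k]
      exact exists_int_finitePart_coroot hint hV α
    by_cases hbig : ∃ α : 𝔥.root, ∃ z : ℤ, T < z ∧ (finitePart lam + q) (coroot α.1) = z
    · obtain ⟨α, z, hz, hq⟩ := hbig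
      exact Or.inr ⟨α, z, hz, hq, weightSpace_sub_root_add_ne_bot hint hK₀ hK hV α (hr α)
        ((hT α).trans_lt (by exact_mod_cast hz)) hq⟩
    · push Not at hbig
      refine Or.inl fun α => ?_
      obtain ⟨z, hz⟩ := hint' α
      refine ⟨z, abs_le.2 ⟨?_, ?_⟩, hz⟩
      · by_contra! h
        refine hbig (negRoot α) (-z) (by omega) ?_
        simp only [negRoot, coroot_neg, map_neg, hz, Int.cast_neg]
      · by_contra! h
        exact hbig α z h hz
  have hbdd : ∀ q, ∃ M : ℤ, ∀ k, weightSpace β n B V (lam + rootWeight q k) ≠ ⊥ → k 0 ≤ M := by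
    intro q
    by_cases h : ∃ k, weightSpace β n B V (lam + rootWeight q k) ≠ ⊥
    · obtain ⟨k, hk⟩ := h
      obtain ⟨M, hM⟩ := exists_forall_le_of_rootWeight_zero hint hfin hc hK₀ hK hk
      refine ⟨M + k 0, fun k' hk' => ?_⟩
      have := hM (k' - k) (by
        rwa [add_assoc, ← rootWeight_add, add_zero, add_sub_cancel])
      rw [Pi.sub_apply] at this
      omega
    · exact ⟨0, fun k hk => absurd ⟨k, hk⟩ h⟩
  choose M hM using hbdd
  obtain ⟨M₀, hM₀⟩ := (hF.image M).bddAbove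
  -- Moving towards `F` decreases the square length of the finite part and raises the degree.
  have hbound : ∀ N : ℕ, ∀ q k, weightSpace β n B V (lam + rootWeight q k) ≠ ⊥ →
      (rootSystem 𝔥).RootForm (finitePart lam + q) (finitePart lam + q) = N → k 0 ≤ M₀ := by
    intro N
    induction N using Nat.strong_induction_on with
    | _ N ih =>
      intro q k hV hN
      rcases hmove q k hV with hq | ⟨α, z, hz, hq, hV'⟩
      · exact (hM q k hV).trans (hM₀ ⟨q, hq, rfl⟩)
      · obtain ⟨N', hN'⟩ := exists_nat_rootForm fun γ =>
          exists_int_finitePart_coroot hint hV' γ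
        rw [finitePart_add_rootWeight] at hN'
        have hlt : N' < N := by
          obtain ⟨R, hR, hR'⟩ := exists_nat_rootForm_root α
          have h := rootForm_sub_root (finitePart lam + q) α
          rw [hN, hR', hq, add_sub_assoc] at h
          rw [h] at hN'
          have h' : (N : ℤ) + R * (1 - z) = N' := by exact_mod_cast hN'
          zify at hR ⊢
          nlinarith
        have := ih N' hlt _ _ hV' hN'
        simp only [Pi.add_apply, Pi.single_eq_same] at this
        omega
  have hbound' : ∀ q k, weightSpace β n B V (lam + rootWeight q k) ≠ ⊥ → k 0 ≤ M₀ := by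
    intro q k hV
    obtain ⟨N, hN⟩ := exists_nat_rootForm fun γ => exists_int_finitePart_coroot hint hV γ
    rw [finitePart_add_rootWeight] at hN
    exact hbound N q k hV hN
  obtain ⟨s, ⟨q, k, hk, hV⟩, hs⟩ := Int.exists_greatest_of_bdd
    (P := fun s => ∃ q k, k 0 = s ∧ weightSpace β n B V (lam + rootWeight q k) ≠ ⊥)
    ⟨M₀, by rintro _ ⟨q, k, rfl, hV⟩; exact hbound' q k hV⟩
    ⟨0, 0, 0, rfl, by rwa [rootWeight_zero, add_zero]⟩
  refine ⟨s, fun q k hV => hs _ ⟨q, k, rfl, hV⟩, ⟨q, k, hk, hV⟩, hF.subset ?_⟩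
  rintro q ⟨k, hk, hV⟩
  rcases hmove q k hV with hq | ⟨α, z, hz, hq, hV'⟩
  · exact hq
  · have := hs _ ⟨_, _, rfl, hV'⟩
    simp only [Pi.add_apply, Pi.single_eq_same] at this
    omega

theorem loop_lie_eq_zero_of_iSup {ι : Sort*} {P : ι → Submodule ℂ 𝔤} {x : 𝔤} (hx : x ∈ ⨆ i, P i)
    {k : Fin (n + 1) → ℤ} {b : B} {v : V} (h : ∀ i, ∀ y ∈ P i, ⁅loop β y k b, v⁆ = 0) :
    ⁅loop β x k b, v⁆ = 0 := by
  refine Submodule.iSup_induction P (motive := fun y => ⁅loop β y k b, v⁆ = 0) hx h ?_ ?_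
  · rw [loop_zero, zero_lie]
  · intro y z hy hz
    rw [loop_add, add_lie, hy, hz, add_zero]

theorem exists_highest_weight_vector (hint : IsIntegrable β n B V)
    (hfin : ∀ lam : Module.Dual ℂ (CartanH 𝔥 n), FiniteDimensional ℂ (weightSpace β n B V lam))
    {c : ℕ} (hc : 0 < c) (hK₀ : ∀ v : V, ⁅K β n B 0, v⁆ = (c : ℂ) • v)
    (hK : ∀ i : Fin (n + 1), i ≠ 0 → ∀ v : V, ⁅K β n B i, v⁆ = 0) [Nontrivial V]
    (Δ : (rootSystem 𝔥).Base) :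
    ∃ lam, ∃ v ∈ weightSpace β n B V lam, v ≠ 0 ∧ ∀ u ∈ toroidalPlus Δ β n B, ⁅u, v⁆ = 0 := by
  obtain ⟨lam, hlam⟩ : ∃ lam, weightSpace β n B V lam ≠ ⊥ := by
    by_contra! h
    have := hint.iSup_weightSpace
    simp only [h, iSup_bot] at this
    exact bot_ne_top this
  obtain ⟨s, hs, hne, hfinite⟩ := exists_maximal_degree hint hfin hc hK₀ hK hlam
  obtain ⟨f, hf⟩ := exists_dual_eq_height Δ
  obtain ⟨q, ⟨k, hk, hV⟩, hmax⟩ := Set.exists_max_image _ (fun q => (f q).re) hfinite hne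
  obtain ⟨v, hv, hv0⟩ := (Submodule.ne_bot_iff _).1 hV
  -- `τ(B)⁺` maps `v` to weight spaces of higher degree, or of the same degree and greater height.
  have hdeg : ∀ (q' : Module.Dual ℂ 𝔥) (k' : Fin (n + 1) → ℤ), 0 < k' 0 → ∀ w : V,
      w ∈ weightSpace β n B V (lam + rootWeight q k + rootWeight q' k') → w = 0 := by
    intro q' k' hk' w hw
    by_contra hw0
    rw [add_assoc, ← rootWeight_add] at hw
    have := hs _ _ ((Submodule.ne_bot_iff _).2 ⟨w, hw, hw0⟩)
    rw [Pi.add_apply] at this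
    omega
  have hheight : ∀ (α : 𝔥.root) (k' : Fin (n + 1) → ℤ), Δ.IsPos α → k' 0 = 0 → ∀ w : V,
      w ∈ weightSpace β n B V (lam + rootWeight q k + rootWeight α.1.toLinear k') → w = 0 := by
    intro α k' hα hk' w hw
    by_contra hw0
    rw [add_assoc, ← rootWeight_add] at hw
    have := hmax _ ⟨_, by rw [Pi.add_apply, hk, hk', add_zero],
      (Submodule.ne_bot_iff _).2 ⟨w, hw, hw0⟩⟩
    rw [map_add, hf, Complex.add_re, Complex.intCast_re] at this
    have hα' : (0 : ℝ) < Δ.height α := by exact_mod_cast hα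
    linarith
  refine ⟨_, v, hv, hv0, fun u hu => ?_⟩
  induction hu using Submodule.span_induction with
  | zero => exact zero_lie v
  | add u w _ _ hu hw => rw [add_lie, hu, hw, add_zero]
  | smul a u _ hu => rw [smul_lie, hu, smul_zero]
  | mem u hu =>
    rcases hu with (⟨x, hx, m, b, hm, rfl⟩ | ⟨x, m, b, hm, rfl⟩) | ⟨i, m, b, hm, rfl⟩
    · refine loop_lie_eq_zero_of_iSup hx fun α y hy => ?_
      refine loop_lie_eq_zero_of_iSup hy fun hα y hy => ?_
      refine hheight α m hα hm _ (loop_lie_mem_weightSpace ?_ m b hv)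
      exact hy
    · have hx : x ∈ ⨆ χ : LieModule.Weight ℂ 𝔥 𝔤,
          (LieAlgebra.rootSpace 𝔥 χ : LieSubmodule ℂ 𝔥 𝔤).toSubmodule := by
        rw [← LieSubmodule.iSup_toSubmodule, LieModule.iSup_genWeightSpace_eq_top']
        trivial
      refine loop_lie_eq_zero_of_iSup hx fun χ y hy => ?_
      refine hdeg χ.toLinear m hm _ (loop_lie_mem_weightSpace ?_ m b hv)
      exact hy
    · exact hdeg 0 m hm _ (lie_mem_weightSpace (cartanIncl_lie_central β m i b) hv)

/-- A weight vector killed by the root vectors of a real root takes a non-negative integral value on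
its coroot. -/
theorem exists_nat_apply_realCoroot (hint : IsIntegrable β n B V)
    {lam : Module.Dual ℂ (CartanH 𝔥 n)} {v : V} (hv : v ∈ weightSpace β n B V lam) (hv0 : v ≠ 0)
    (α : 𝔥.root) (m : Fin (n + 1) → ℤ)
    (h : ∀ x ∈ LieAlgebra.rootSpace 𝔥 α.1, ⁅loop β x m (1 : B), v⁆ = 0) :
    ∃ N : ℕ, lam (realCoroot β α.1 m) = N := by
  by_cases hne : cartanIncl β n B (realCoroot β α.1 m) = 0
  · have h := hv (realCoroot β α.1 m)
    rw [hne, zero_lie, eq_comm, smul_eq_zero] at h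
    exact ⟨0, by simpa using h.resolve_right hv0⟩
  · obtain ⟨x, hx, y, hy, t⟩ := exists_isSl2Triple β α m hne
    have P : t.HasPrimitiveVectorWith v (lam (realCoroot β α.1 m)) := ⟨hv0, hv _, h x hx⟩
    obtain ⟨N, hN⟩ := hint.locally_nilpotent (negRoot α) y hy (-m) 1 v
    exact P.exists_nat_of_toEnd_pow_eq_zero hN

theorem isAffineDominantIntegral_of_highest_weight (hint : IsIntegrable β n B V)
    (Δ : (rootSystem 𝔥).Base) {lam : Module.Dual ℂ (CartanH 𝔥 n)} {v : V}
    (hv : v ∈ weightSpace β n B V lam) (hv0 : v ≠ 0)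
    (h : ∀ u ∈ toroidalPlus Δ β n B, ⁅u, v⁆ = 0) : IsAffineDominantIntegral Δ β lam := by
  refine ⟨fun α hα => exists_nat_apply_realCoroot hint hv hv0 α 0 fun x hx => ?_,
    exists_nat_apply_realCoroot hint hv hv0 (negRoot β) (Pi.single 0 1) fun x _ => ?_⟩
  · refine h _ (Submodule.subset_span (Or.inl (Or.inl ⟨x, ?_, 0, 1, rfl, rfl⟩)))
    exact Submodule.mem_iSup_of_mem α
      (Submodule.mem_iSup_of_mem (RootPairing.Base.isPos_of_mem_support hα) hx)
  · exact h _ (Submodule.subset_span (Or.inl (Or.inr ⟨x, Pi.single 0 1, 1, by simp, rfl⟩)))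

end Maximal

end Toroidal

end

theorem proposition3p1 {𝔤 : Type*} [LieRing 𝔤] [LieAlgebra ℂ 𝔤] [FiniteDimensional ℂ 𝔤]
    [LieAlgebra.IsSimple ℂ 𝔤] (𝔥 : LieSubalgebra ℂ 𝔤) [𝔥.IsCartanSubalgebra]
    (Δ : (LieAlgebra.IsKilling.rootSystem 𝔥).Base)
    (β : 𝔥.root) (hβ : Toroidal.IsMaximalRoot Δ β)
    (n : ℕ) (B : Type*) [CommRing B] [Algebra ℂ B] [Algebra.FiniteType ℂ B]
    (V : Type*) [AddCommGroup V] [Module ℂ V] [LieRingModule (Toroidal.LoopToroidal β n B) V]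
    [LieModule ℂ (Toroidal.LoopToroidal β n B) V]
    (hirr : LieModule.IsIrreducible ℂ (Toroidal.LoopToroidal β n B) V)
    (hint : Toroidal.IsIntegrable β n B V)
    (hfin : ∀ lam : Module.Dual ℂ (Toroidal.CartanH 𝔥 n),
      FiniteDimensional ℂ (Toroidal.weightSpace β n B V lam))
    (c₀ : ℕ) (hc₀ : 0 < c₀)
    (hK₀ : ∀ v : V, ⁅Toroidal.LoopToroidal.K β n B 0, v⁆ = (c₀ : ℂ) • v)
    (hK : ∀ i : Fin (n + 1), i ≠ 0 → ∀ v : V, ⁅Toroidal.LoopToroidal.K β n B i, v⁆ = 0) :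
    (∃ lam : Module.Dual ℂ (Toroidal.CartanH 𝔥 n), ∃ v ∈ Toroidal.weightSpace β n B V lam,
      v ≠ 0 ∧ ∀ u ∈ Toroidal.toroidalPlus Δ β n B, ⁅u, v⁆ = 0) ∧
    (∀ lam : Module.Dual ℂ (Toroidal.CartanH 𝔥 n), ∀ v ∈ Toroidal.weightSpace β n B V lam,
      v ≠ 0 → (∀ u ∈ Toroidal.toroidalPlus Δ β n B, ⁅u, v⁆ = 0) →
        Toroidal.IsAffineDominantIntegral Δ β lam) := by
  have := LieModule.nontrivial_of_isIrreducible ℂ (Toroidal.LoopToroidal β n B) V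
  exact ⟨Toroidal.exists_highest_weight_vector hint hfin hc₀ hK₀ hK Δ,
    fun lam v hv hv0 h => Toroidal.isAffineDominantIntegral_of_highest_weight hint Δ hv hv0 h⟩
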